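/- Let $\mathcal{C}$ be a path category: a category with two classes of maps, the fibrations and the weak equivalences (a map in both classes is called an acyclic fibration), such that (1) fibrations are closed under composition; (2) the pullback of a fibration along any map exists and is a fibration; (3) the pullback of an acyclic fibration along any map is an acyclic fibration; (4) weak equivalences satisfy 2-out-of-6: if $gf$ and $hg$ are weak equivalences, then so are $f,g,h$ and $hgf$; (5) isomorphisms are acyclic fibrations, and every acyclic fibration has a section; (6) every object $B$ has a path object, i.e. a factorisation of the diagonal $B \to B\times B$ as a weak equivalence $B \to PB$ followed by a fibration $(s,t): PB \to B \times B$; (7) $\mathcal{C}$ has a terminal object $1$, and every map $X \to 1$ is a fibration. Two maps $f,g: Y \to X$ are homotopic, $f \simeq g$, if for some path object $PX$ there is $h: Y \to PX$ with $sh = f$ and $th = g$. A map $f: X \to Y$ is a homotopy equivalence if there is $g: Y \to X$ with $gf \simeq 1_X$ and $fg \simeq 1_Y$. A square with sides $q_1: D \to A$, $q_2: D \to B$, $f: A \to I$, $g: B \to I$ is a homotopy pullback if there is a homotopy equivalence $h: D \to A\times_I^h B$ with $p_1 h = q_1$ and $p_2 h = q_2$, where $(p_1,p_2): A\times^h_I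 B \to A \times B$ is the pullback of $(s,t): PI \to I \times I$ along $f \times g$. An object $0$ is homotopy initial if for every object $A$ there is a map $0 \to A$, unique up to homotopy. A homotopy sum of $A$ and $B$ is an object $A+B$ with maps $i_A : A \to A+B$, $i_B : B \to A+B$ such that for all $f: A \to X$, $g: B \to X$ there is a map $h: A+B \to X$, unique up to homotopy, with $hi_A \simeq f$ and $hi_B \simeq g$. It is stable if for all homotopy pullback squares $$\begin{array}{ccc} C & \to & X \\ \downarrow & & \downarrow \\ A & \to & A+B \end{array} \qquad \begin{array}{ccc} D & \to & X \\ \downarrow & & \downarrow \\ B & \to & A+B \end{array}$$ with the same map $X \to A+B$ on the right, the maps $C \to X \leftarrow D$ form a homotopy sum. It is disjoint if there is a homotopy pullback square with sides $0 \to A$, $0 \to B$, $i_A$, $i_B$, where $0$ is homotopy initial. The path category $\mathcal{C}$ is homotopy extensive if it has a homotopy initial object and all homotopy sums of two objects, and these are stable and disjoint. A homotopy equivalence relation on $X$ is a fibration $\rho = (\rho_1,\rho_2): R \to X\times X$ for which there are maps $r: X \to R$ with $\rho r = \Delta_X$; $\sigma: R \to R$ with $\rho_1 \sigma = \rho_2$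 and $\rho_2\sigma = \rho_1$; and $\tau: R\times_X R \to R$ with $\rho_1 \tau = \rho_1 q_1$ and $\rho_2\tau = \rho_2 q_2$, where $q_1, q_2 : R \times_X R \to R$ is the pullback of $\rho_2$ and $\rho_1$. The homotopy exact completion $\mathrm{Hex}(\mathcal{C})$ is the category whose objects are the homotopy equivalence relations $(X,\rho: R \to X\times X)$, and whose morphisms $(X,\rho: R\to X\times X) \to (Y,\sigma: S\to Y\times Y)$ are equivalence classes of maps $f: X \to Y$ for which there is $\varphi: R \to S$ with $\sigma\varphi = (f\times f)\rho$, where $f$ and $g$ are identified if there is $H: X \to S$ with $\sigma H = (f,g)$. Theorem. If $\mathcal{C}$ is a homotopy extensive path category, then $\mathrm{Hex}(\mathcal{C})$ is a pretopos. That is, it is exact (it is a regular category in which every equivalence relation is the kernel pair of its quotient) and extensive (it has finite coproducts, and these are disjoint and stable under pullback). -/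

import Mathlib

open CategoryTheory CategoryTheory.Limits HomotopicalAlgebra

universe v u

namespace PathCat

/-- The axioms of a path category, except for the existence of path objects, for a category with
distinguished classes of fibrations and weak equivalences. (`trivialFibrations C` is the class of
acyclic fibrations, i.e. the maps which are both fibrations and weak equivalences.) -/
class PrePathCategory (C : Type u) [Category.{v} C] [CategoryWithFibrations C]
    [CategoryWithWeakEquivalences C] : Prop where
  /-- Fibrations are closed under composition. -/
  fib_comp : (fibrations C).IsStableUnderComposition
  /-- The pullback of a fibration along any other map exists ... -/
  hasPullback_of_fib : ∀ {X Y B : C} (f : X ⟶ B) (g : Y ⟶ B), fibrations C f → HasPullback f g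
  /-- ... and is again a fibration. -/
  fib_baseChange : (fibrations C).IsStableUnderBaseChange
  /-- The pullback of an acyclic fibration along any other map is an acyclic fibration. -/
  trivFib_baseChange : (trivialFibrations C).IsStableUnderBaseChange
  /-- Weak equivalences satisfy 2-out-of-6. -/
  two_out_of_six : ∀ {X Y Z W : C} (f : X ⟶ Y) (g : Y ⟶ Z) (h : Z ⟶ W),
    weakEquivalences C (f ≫ g) → weakEquivalences C (g ≫ h) →
      weakEquivalences C f ∧ weakEquivalences C g ∧ weakEquivalences C h ∧
        weakEquivalences C (f ≫ g ≫ h)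
  /-- Isomorphisms are acyclic fibrations. -/
  trivFib_of_isIso : ∀ {X Y : C} (f : X ⟶ Y), IsIso f → trivialFibrations C f
  /-- Every acyclic fibration has a section. -/
  exists_section : ∀ {X Y : C} (f : X ⟶ Y), trivialFibrations C f → ∃ s : Y ⟶ X, s ≫ f = 𝟙 Y
  /-- There is a terminal object ... -/
  hasTerminal : HasTerminal C
  /-- ... and every map to it is a fibration. -/
  fib_to_terminal : ∀ X : C, fibrations C (terminal.from X)

attribute [instance] PrePathCategory.hasTerminal

section Products

variable (C : Type u) [Category.{v} C] [CategoryWithFibrations C]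
  [CategoryWithWeakEquivalences C] [PrePathCategory C]

/-- The product of `X` and `Y` is the pullback of the fibration `X ⟶ 1` along `Y ⟶ 1`. -/
instance hasBinaryProducts : HasBinaryProducts C := by
  have key : ∀ X Y : C, HasLimit (pair X Y) := fun X Y => by
    have : HasPullback (terminal.from X) (terminal.from Y) :=
      PrePathCategory.hasPullback_of_fib _ _ (PrePathCategory.fib_to_terminal X)
    have sq := IsPullback.of_hasPullback (terminal.from X) (terminal.from Y)
    exact ⟨⟨_, BinaryFan.isLimitMk (fst := pullback.fst (terminal.from X) (terminal.from Y))
      (snd := pullback.snd (terminal.from X) (terminal.from Y))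
      (fun s => sq.lift s.fst s.snd (by ext)) (fun _ => sq.lift_fst _ _ _)
      (fun _ => sq.lift_snd _ _ _) (fun _ _ h₁ h₂ => sq.hom_ext
        (h₁.trans (sq.lift_fst _ _ _).symm) (h₂.trans (sq.lift_snd _ _ _).symm))⟩⟩
  exact hasBinaryProducts_of_hasLimit_pair C

variable {C}

theorem fib_fst (X Y : C) : fibrations C (prod.fst : X ⨯ Y ⟶ X) :=
  PrePathCategory.fib_baseChange.of_isPullback (IsPullback.of_hasBinaryProduct' X Y).flip
    (PrePathCategory.fib_to_terminal Y)

end Products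

/-- A path category: a category with fibrations and weak equivalences satisfying the axioms above,
in which every object `B` has a path object, i.e. the diagonal `B ⟶ B ⨯ B` factors as a weak
equivalence `ι : B ⟶ P` followed by a fibration `p : P ⟶ B ⨯ B`. -/
class PathCategory (C : Type u) [Category.{v} C] [CategoryWithFibrations C]
    [CategoryWithWeakEquivalences C] : Prop extends PrePathCategory C where
  exists_pathObject : ∀ B : C, ∃ P : PathObject B, P.IsGood

variable {C : Type u} [Category.{v} C] [CategoryWithFibrations C]
  [CategoryWithWeakEquivalences C] [PathCategory C]

/-! ### Homotopy -/

/-- `f` and `g` are homotopic: for some path object `(s, t) : P ⟶ X ⨯ X` of `X` there is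
`h : Y ⟶ P` with `h ≫ s = f` and `h ≫ t = g`. -/
def Homotopic {Y X : C} (f g : Y ⟶ X) : Prop :=
  ∃ P : PathObject X, P.IsGood ∧ ∃ h : Y ⟶ P.P, h ≫ P.p₀ = f ∧ h ≫ P.p₁ = g

/-- Homotopy equivalences. -/
def IsHomotopyEquivalence {X Y : C} (f : X ⟶ Y) : Prop :=
  ∃ g : Y ⟶ X, Homotopic (f ≫ g) (𝟙 X) ∧ Homotopic (g ≫ f) (𝟙 Y)

/-- The square
```
  D --q₂--> B
  |         |
  q₁        g
  v         v
  A --f---> I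
```
is a homotopy pullback: there is a homotopy equivalence `h : D ⟶ W` over both `A` and `B`, where
`w : W ⟶ A ⨯ B` is the pullback of a path object `P ⟶ I ⨯ I` along `f × g`. (In particular the
square commutes up to homotopy.) -/
def IsHomotopyPullback {D A B I : C} (q₁ : D ⟶ A) (q₂ : D ⟶ B) (f : A ⟶ I) (g : B ⟶ I) : Prop :=
  ∃ P : PathObject I, P.IsGood ∧
    ∃ (W : C) (w : W ⟶ A ⨯ B) (k : W ⟶ P.P), IsPullback w k (prod.map f g) P.p ∧
      ∃ h : D ⟶ W, IsHomotopyEquivalence h ∧ h ≫ w ≫ prod.fst = q₁ ∧ h ≫ w ≫ prod.snd = q₂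

/-! ### Homotopy sums -/

/-- Homotopy initial objects. -/
def IsHomotopyInitial (Z : C) : Prop :=
  ∀ A : C, (∃ f : Z ⟶ A, ∀ g : Z ⟶ A, Homotopic g f)

/-- `S`, together with `i : A ⟶ S` and `j : B ⟶ S`, is a homotopy sum of `A` and `B`. -/
def IsHomotopySum {A B S : C} (i : A ⟶ S) (j : B ⟶ S) : Prop :=
  ∀ (X : C) (f : A ⟶ X) (g : B ⟶ X), ∃ h : S ⟶ X,
    (Homotopic (i ≫ h) f ∧ Homotopic (j ≫ h) g) ∧
      ∀ h' : S ⟶ X, Homotopic (i ≫ h') f → Homotopic (j ≫ h') g → Homotopic h' h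

/-- Stability of a homotopy sum: in every diagram
```
  D --k--> X <--l-- E
  |        |        |
  a        x        b
  v        v        v
  A --i--> S <--j-- B
```
in which both squares are homotopy pullbacks, the top row is a homotopy sum. -/
def IsStableSum {A B S : C} (i : A ⟶ S) (j : B ⟶ S) : Prop :=
  ∀ ⦃D X E : C⦄ (k : D ⟶ X) (l : E ⟶ X) (a : D ⟶ A) (x : X ⟶ S) (b : E ⟶ B),
    IsHomotopyPullback a k i x → IsHomotopyPullback b l j x → IsHomotopySum k l

/-- Disjointness of a homotopy sum: the homotopy pullback of the two injections is a homotopy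
initial object. -/
def IsDisjointSum {A B S : C} (i : A ⟶ S) (j : B ⟶ S) : Prop :=
  ∃ (Z : C) (a : Z ⟶ A) (b : Z ⟶ B), IsHomotopyInitial Z ∧ IsHomotopyPullback a b i j

variable (C) in
/-- A path category is homotopy extensive if it has a homotopy initial object and homotopy sums
which are stable and disjoint. -/
structure IsHomotopyExtensive : Prop where
  exists_initial : ∃ Z : C, IsHomotopyInitial Z
  exists_sum : ∀ A B : C, ∃ (S : C) (i : A ⟶ S) (j : B ⟶ S),
    IsHomotopySum i j ∧ IsStableSum i j ∧ IsDisjointSum i j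

/-! ### The homotopy exact completion -/

/-- `p = (p₁, p₂) : R ⟶ X ⨯ X` is a homotopy equivalence relation. -/
structure IsHomotopyEquivRel {X R : C} (p : R ⟶ X ⨯ X) : Prop where
  fib : fibrations C p
  refl : ∃ r : X ⟶ R, r ≫ p = diag X
  symm : ∃ s : R ⟶ R, s ≫ p ≫ prod.fst = p ≫ prod.snd ∧ s ≫ p ≫ prod.snd = p ≫ prod.fst
  /-- Here `T` is the pullback `R ×_X R` of `p₂` and `p₁`. -/
  trans : ∀ ⦃T : C⦄ (q₁ q₂ : T ⟶ R), IsPullback q₁ q₂ (p ≫ prod.snd) (p ≫ prod.fst) →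
    ∃ t : T ⟶ R, t ≫ p ≫ prod.fst = q₁ ≫ p ≫ prod.fst ∧ t ≫ p ≫ prod.snd = q₂ ≫ p ≫ prod.snd

theorem IsHomotopyEquivRel.hasPullback {X R : C} {p : R ⟶ X ⨯ X} (hp : IsHomotopyEquivRel p) :
    HasPullback (p ≫ prod.snd) (p ≫ prod.fst) := by
  have := PrePathCategory.hasPullback_of_fib (p ≫ prod.fst) (p ≫ prod.snd)
    (PrePathCategory.fib_comp.comp_mem _ _ hp.fib (fib_fst X X))
  exact hasPullback_symmetry _ _

variable (C) in
/-- Objects of the homotopy exact completion of `C`: the homotopy equivalence relations in `C`. -/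
structure Hex where
  X : C
  R : C
  ρ : R ⟶ X ⨯ X
  isEquivRel : IsHomotopyEquivRel ρ

namespace Hex

/-- Maps `f : A.X ⟶ B.X` for which there is a map `φ : A.R ⟶ B.R` over `f × f`. -/
def PreHom (A B : Hex C) : Type v :=
  { f : A.X ⟶ B.X // ∃ φ : A.R ⟶ B.R, φ ≫ B.ρ = A.ρ ≫ prod.map f f }

/-- `f` and `g` are identified if `(f, g) : A.X ⟶ B.X ⨯ B.X` factors through `B.ρ`. -/
def Rel {A B : Hex C} (f g : PreHom A B) : Prop :=
  ∃ H : A.X ⟶ B.R, H ≫ B.ρ = prod.lift f.1 g.1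

theorem rel_equivalence (A B : Hex C) : Equivalence (Rel (A := A) (B := B)) where
  refl f := by
    obtain ⟨r, hr⟩ := B.isEquivRel.refl
    refine ⟨f.1 ≫ r, ?_⟩
    rw [Category.assoc, hr]
    ext <;> simp
  symm := by
    rintro f g ⟨H, hH⟩
    obtain ⟨s, h₁, h₂⟩ := B.isEquivRel.symm
    refine ⟨H ≫ s, ?_⟩
    ext
    · simp [h₁, reassoc_of% hH, prod.lift_fst, prod.lift_snd]
    · simp [h₂, reassoc_of% hH, prod.lift_fst, prod.lift_snd]
  trans := by
    rintro f g h ⟨H, hH⟩ ⟨K, hK⟩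
    have := B.isEquivRel.hasPullback
    obtain ⟨t, h₁, h₂⟩ := B.isEquivRel.trans _ _ (IsPullback.of_hasPullback _ _)
    have w : H ≫ B.ρ ≫ prod.snd = K ≫ B.ρ ≫ prod.fst := by
      simp [reassoc_of% hH, reassoc_of% hK, prod.lift_fst, prod.lift_snd]
    refine ⟨pullback.lift H K w ≫ t, ?_⟩
    ext
    · rw [Category.assoc, Category.assoc, h₁, pullback.lift_fst_assoc, reassoc_of% hH,
        prod.lift_fst, prod.lift_fst]
    · rw [Category.assoc, Category.assoc, h₂, pullback.lift_snd_assoc, reassoc_of% hK,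
        prod.lift_snd, prod.lift_snd]

/-- The setoid of maps with equality up to `Rel`. -/
def homSetoid (A B : Hex C) : Setoid (PreHom A B) := ⟨Rel, rel_equivalence A B⟩

/-- The identity. -/
def PreHom.id (A : Hex C) : PreHom A A := ⟨𝟙 _, 𝟙 _, by simp⟩

/-- Composition. -/
def PreHom.comp {A B D : Hex C} (f : PreHom A B) (g : PreHom B D) : PreHom A D :=
  ⟨f.1 ≫ g.1, by
    obtain ⟨φ, hφ⟩ := f.2
    obtain ⟨ψ, hψ⟩ := g.2
    exact ⟨φ ≫ ψ, by simp [hψ, reassoc_of% hφ]⟩⟩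

theorem PreHom.comp_rel {A B D : Hex C} (f f' : PreHom A B) (g g' : PreHom B D)
    (hf : Rel f f') (hg : Rel g g') : Rel (f.comp g) (f'.comp g') := by
  refine (rel_equivalence A D).trans (y := f.comp g') ?_ ?_
  · obtain ⟨H, hH⟩ := hg
    refine ⟨f.1 ≫ H, ?_⟩
    rw [Category.assoc, hH]
    ext <;> simp [PreHom.comp]
  · obtain ⟨H, hH⟩ := hf
    obtain ⟨ψ, hψ⟩ := g'.2
    refine ⟨H ≫ ψ, ?_⟩
    rw [Category.assoc, hψ, reassoc_of% hH]
    ext <;> simp [PreHom.comp]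

/-- The homotopy exact completion of `C`. -/
instance : Category.{v} (Hex C) where
  Hom A B := Quotient (homSetoid A B)
  id A := Quotient.mk _ (PreHom.id A)
  comp {A B D} := Quotient.map₂ PreHom.comp
    (fun f f' hf g g' hg => PreHom.comp_rel f f' g g' hf hg)
  id_comp := by
    rintro A B ⟨f⟩
    exact congrArg (Quotient.mk _) (Subtype.ext (Category.id_comp _))
  comp_id := by
    rintro A B ⟨f⟩
    exact congrArg (Quotient.mk _) (Subtype.ext (Category.comp_id _))
  assoc := by
    rintro A B D E ⟨f⟩ ⟨g⟩ ⟨h⟩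
    exact congrArg (Quotient.mk _) (Subtype.ext (Category.assoc _ _ _))

end Hex

/-! ### Pretoposes -/

/-- A pretopos is a category which is exact, i.e. regular and such that every equivalence relation
has an effective quotient, and extensive, i.e. with finite coproducts which are disjoint and stable
under pullback. -/
structure IsPretopos (D : Type u) [Category.{v} D] : Prop where
  regular : Regular D
  effective : ∀ ⦃R A : D⦄ (p₁ p₂ : R ⟶ A), IsEquivalenceRelation p₁ p₂ →
    IsEffectiveEquivalenceRelation p₁ p₂
  extensive : FinitaryExtensive D

end PathCat

set_option linter.unusedSectionVars false

namespace PathCat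

attribute [local simp] prod.lift_fst prod.lift_snd prod.lift_fst_assoc prod.lift_snd_assoc

variable {C : Type u} [Category.{v} C] [CategoryWithFibrations C]
  [CategoryWithWeakEquivalences C]

/-! ### Weak equivalences and fibrations -/

section PrePathCategory

variable [PrePathCategory C]

/-! The argument works with generalised elements `T ⟶ X` and with relations on them of the form
"factors through a fixed fibration" (`IsFibrational`, `IsFibRel`). Fibrations pull back, compose and
include product projections, so these relations are closed under substitution, conjunction and
existential quantification. They can be checked after precomposing with a weak equivalence
(`IsFibRel.of_weq`), hence are homotopy invariant, and can be checked on the two parts of a homotopy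
sum (`IsFibRel.of_sum`). An object of `Hex C` is an object of `C` with a fibrational equivalence
relation, and pullbacks in `Hex C` can be tested on generalised elements (`Hex.isPullback_iff`).

Exactness needs no sums. A quotient keeps the underlying object and coarsens the relation, and the
regular epimorphisms are the maps having a section in `C` up to the relation of the target, a
property that survives pullback.

For extensivity, the coproduct lives on the homotopy sum of the underlying objects and is
characterised elementwise by `IsPointwiseCoproduct`. The three ingredients in `C` are that maps into
a homotopy sum split (`IsHomotopySum.exists_split`), that injections are disjoint
(`IsHomotopySum.disjoint`) and that they are monic up to homotopy (`IsHomotopySum.mono`). The van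
Kampen property is then an element chase. -/

theorem fib_isIso {X Y : C} (f : X ⟶ Y) [IsIso f] : fibrations C f :=
  (PrePathCategory.trivFib_of_isIso f inferInstance).1

theorem fib_comp' {X Y Z : C} {f : X ⟶ Y} {g : Y ⟶ Z} (hf : fibrations C f)
    (hg : fibrations C g) : fibrations C (f ≫ g) :=
  PrePathCategory.fib_comp.comp_mem _ _ hf hg

theorem fib_snd (X Y : C) : fibrations C (prod.snd : X ⨯ Y ⟶ Y) :=
  PrePathCategory.fib_baseChange.of_isPullback (IsPullback.of_hasBinaryProduct' X Y)
    (PrePathCategory.fib_to_terminal X)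

theorem weq_isIso {X Y : C} (f : X ⟶ Y) [IsIso f] : weakEquivalences C f :=
  (PrePathCategory.trivFib_of_isIso f inferInstance).2

theorem weq_of_comp_left {X Y Z : C} {f : X ⟶ Y} {g : Y ⟶ Z} (hf : weakEquivalences C f)
    (hfg : weakEquivalences C (f ≫ g)) : weakEquivalences C g :=
  (PrePathCategory.two_out_of_six (𝟙 X) f g (by simpa using hf) hfg).2.2.1

theorem weq_of_comp_right {X Y Z : C} {f : X ⟶ Y} {g : Y ⟶ Z} (hg : weakEquivalences C g)
    (hfg : weakEquivalences C (f ≫ g)) : weakEquivalences C f :=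
  (PrePathCategory.two_out_of_six f g (𝟙 Z) hfg (by simpa using hg)).1

theorem weq_of_section {X Y : C} {s : Y ⟶ X} {f : X ⟶ Y} (hf : weakEquivalences C f)
    (h : s ≫ f = 𝟙 Y) : weakEquivalences C s :=
  weq_of_comp_right hf (h ▸ weq_isIso (𝟙 Y))

/-- The pullback of a fibration along any map, with the fibration on the left. -/
theorem exists_isPullback {R Z B : C} {ρ : R ⟶ Z} (hρ : fibrations C ρ) (v : B ⟶ Z) :
    ∃ (E : C) (q : E ⟶ B) (e : E ⟶ R), IsPullback q e v ρ ∧ fibrations C q := by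
  have := PrePathCategory.hasPullback_of_fib ρ v hρ
  have h := IsPullback.of_hasPullback ρ v
  exact ⟨_, _, _, h.flip, PrePathCategory.fib_baseChange.of_isPullback h hρ⟩

theorem trivFib_of_isPullback {R Z B E : C} {ρ : R ⟶ Z} {v : B ⟶ Z} {q : E ⟶ B} {e : E ⟶ R}
    (h : IsPullback q e v ρ) (hρ : trivialFibrations C ρ) : trivialFibrations C q :=
  PrePathCategory.trivFib_baseChange.of_isPullback h.flip hρ

theorem isPullback_fst_map {A B E F : C} (f : A ⟶ B) (g : E ⟶ F) [IsIso g] :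
    IsPullback (prod.fst : A ⨯ E ⟶ A) (prod.map f g) f (prod.fst : B ⨯ F ⟶ B) := by
  refine ⟨⟨by simp⟩, ⟨PullbackCone.IsLimit.mk _
    (fun s => prod.lift s.fst (s.snd ≫ prod.snd ≫ inv g))
    (by simp) (fun s => ?_) (fun s m h₁ h₂ => ?_)⟩⟩
  · ext
    · simp [s.condition]
    · simp
  · ext
    · simpa using h₁
    · simp [← h₂]

theorem isPullback_snd_map {A B E F : C} (f : A ⟶ B) (g : E ⟶ F) [IsIso f] :
    IsPullback (prod.snd : A ⨯ E ⟶ E) (prod.map f g) g (prod.snd : B ⨯ F ⟶ F) := by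
  refine ⟨⟨by simp⟩, ⟨PullbackCone.IsLimit.mk _
    (fun s => prod.lift (s.snd ≫ prod.fst ≫ inv f) s.fst)
    (by simp) (fun s => ?_) (fun s m h₁ h₂ => ?_)⟩⟩
  · ext
    · simp
    · simp [s.condition]
  · ext
    · simp [← h₂]
    · simpa using h₁

theorem trivFib_p₀ {X : C} (P : PathObject X) (hP : P.IsGood) : trivialFibrations C P.p₀ :=
  ⟨by
    rw [← P.p_fst]
    exact fib_comp' ((fibration_iff _).1 hP.fibration_p) (fib_fst X X),
   weq_of_comp_left ((weakEquivalence_iff _).1 P.weakEquivalence_ι) (P.ι_p₀ ▸ weq_isIso (𝟙 X))⟩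

/-- The mapping path object of `f`. -/
theorem exists_mappingPath {A E : C} (f : A ⟶ E) (P : PathObject E) (hP : P.IsGood) :
    ∃ (M : C) (m : M ⟶ A ⨯ E) (k : M ⟶ P.P) (s : A ⟶ M),
      IsPullback m k (prod.map f (𝟙 E)) P.p ∧ fibrations C m ∧ weakEquivalences C s ∧
        s ≫ m = prod.lift (𝟙 A) f := by
  obtain ⟨M, m, k, h, hm⟩ := exists_isPullback ((fibration_iff _).1 hP.fibration_p)
    (prod.map f (𝟙 E))
  have w : prod.lift (𝟙 A) f ≫ prod.map f (𝟙 E) = (f ≫ P.ι) ≫ P.p := by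
    ext <;> simp
  refine ⟨M, m, k, h.lift _ _ w, h, hm, ?_, h.lift_fst _ _ w⟩
  -- Pasting exhibits `M ⟶ A` as a pullback of the acyclic fibration `P.p₀`; the map `s` is a
  -- section of it, hence a weak equivalence.
  have h' : IsPullback (m ≫ prod.fst) k f P.p₀ := by
    simpa using h.flip.paste_vert (isPullback_fst_map f (𝟙 E)).flip |>.flip
  exact weq_of_section (trivFib_of_isPullback h' (trivFib_p₀ P hP)).2
    (by rw [h.lift_fst_assoc, prod.lift_fst])

end PrePathCategory

variable [PathCategory C]

/-- Lifting along weak equivalences against fibrations, with the lower triangle commuting. -/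
theorem exists_lift_of_weq {A B R Z : C} {ρ : R ⟶ Z} (hρ : fibrations C ρ) {w : A ⟶ B}
    (hw : weakEquivalences C w) (v : B ⟶ Z) (H : A ⟶ R) (hH : H ≫ ρ = w ≫ v) :
    ∃ K : B ⟶ R, K ≫ ρ = v := by
  obtain ⟨E, q, e, h, hq⟩ := exists_isPullback hρ v
  -- Factor `A ⟶ E` through its mapping path object `M`. The resulting fibration `M ⟶ B` is a weak
  -- equivalence because `w` and `s` are; a section of it gives the lift.
  obtain ⟨P, hP⟩ := PathCategory.exists_pathObject E
  obtain ⟨M, m, k, s, -, hm, hs, hsm⟩ := exists_mappingPath (h.lift w H hH.symm) P hP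
  have hf : s ≫ (m ≫ prod.snd) ≫ q = w := by
    rw [← Category.assoc, ← Category.assoc s, hsm]
    simp
  obtain ⟨t, ht⟩ := PrePathCategory.exists_section ((m ≫ prod.snd) ≫ q)
    ⟨fib_comp' (fib_comp' hm (fib_snd _ _)) hq, weq_of_comp_left hs (hf ▸ hw)⟩
  refine ⟨t ≫ m ≫ prod.snd ≫ e, ?_⟩
  simp only [Category.assoc] at ht ⊢
  rw [← h.w, reassoc_of% ht]

/-! ### Fibrational predicates -/

/-- A predicate on maps into `X` is fibrational if it is the property of factoring through some
fixed fibration. -/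
def IsFibrational {X : C} (Q : ∀ ⦃T : C⦄, (T ⟶ X) → Prop) : Prop :=
  ∃ (R : C) (ρ : R ⟶ X), fibrations C ρ ∧ ∀ ⦃T : C⦄ (f : T ⟶ X), Q f ↔ ∃ H : T ⟶ R, H ≫ ρ = f

namespace IsFibrational

variable {X : C} {Q : ∀ ⦃T : C⦄, (T ⟶ X) → Prop}

theorem congr {Q' : ∀ ⦃T : C⦄, (T ⟶ X) → Prop} (hQ : IsFibrational Q)
    (h : ∀ ⦃T : C⦄ (f : T ⟶ X), Q f ↔ Q' f) : IsFibrational Q' := by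
  obtain ⟨R, ρ, hρ, hR⟩ := hQ
  exact ⟨R, ρ, hρ, fun T f => (h f).symm.trans (hR f)⟩

theorem precomp (hQ : IsFibrational Q) {T T' : C} (w : T' ⟶ T) {f : T ⟶ X} (h : Q f) :
    Q (w ≫ f) := by
  obtain ⟨R, ρ, -, hR⟩ := hQ
  obtain ⟨H, rfl⟩ := (hR _).1 h
  exact (hR _).2 ⟨w ≫ H, by simp⟩

theorem of_weq (hQ : IsFibrational Q) {T T' : C} {w : T' ⟶ T} (hw : weakEquivalences C w)
    {f : T ⟶ X} (h : Q (w ≫ f)) : Q f := by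
  obtain ⟨R, ρ, hρ, hR⟩ := hQ
  obtain ⟨H, hH⟩ := (hR _).1 h
  exact (hR _).2 (exists_lift_of_weq hρ hw f H hH)

theorem comap (hQ : IsFibrational Q) {Y : C} (g : Y ⟶ X) :
    IsFibrational (fun T (f : T ⟶ Y) => Q (f ≫ g)) := by
  obtain ⟨R, ρ, hρ, hR⟩ := hQ
  obtain ⟨E, q, e, h, hq⟩ := exists_isPullback hρ g
  refine ⟨E, q, hq, fun T f => ?_⟩
  refine (hR _).trans ?_
  constructor
  · rintro ⟨H, hH⟩
    exact ⟨h.lift f H hH.symm, by simp⟩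
  · rintro ⟨H, rfl⟩
    exact ⟨H ≫ e, by simp [h.w]⟩

/-- Existential quantification: the representing fibration is composed with `g`. -/
theorem exists_along (hQ : IsFibrational Q) {Y : C} {g : X ⟶ Y} (hg : fibrations C g) :
    IsFibrational (fun T (f : T ⟶ Y) => ∃ f' : T ⟶ X, f' ≫ g = f ∧ Q f') := by
  obtain ⟨R, ρ, hρ, hR⟩ := hQ
  refine ⟨R, ρ ≫ g, fib_comp' hρ hg, fun T f => ?_⟩
  simp only [hR]
  constructor
  · rintro ⟨_, rfl, H, rfl⟩
    exact ⟨H, by simp⟩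
  · rintro ⟨H, rfl⟩
    exact ⟨H ≫ ρ, by simp, H, rfl⟩

theorem and {Q' : ∀ ⦃T : C⦄, (T ⟶ X) → Prop} (hQ : IsFibrational Q) (hQ' : IsFibrational Q') :
    IsFibrational (fun T (f : T ⟶ X) => Q f ∧ Q' f) := by
  obtain ⟨R, ρ, hρ, hR⟩ := hQ
  refine ((hQ'.comap ρ).exists_along hρ).congr fun T f => ?_
  rw [hR]
  constructor
  · rintro ⟨H, rfl, h⟩
    exact ⟨⟨H, rfl⟩, h⟩
  · rintro ⟨⟨H, rfl⟩, h⟩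
    exact ⟨H, rfl, h⟩

theorem top : IsFibrational (fun T (_ : T ⟶ X) => True) :=
  ⟨X, 𝟙 X, fib_isIso _, fun T f => ⟨fun _ => ⟨f, by simp⟩, fun _ => trivial⟩⟩

end IsFibrational

/-- The two-variable version of `IsFibrational`. -/
def IsFibRel {X Y : C} (E : ∀ ⦃T : C⦄, (T ⟶ X) → (T ⟶ Y) → Prop) : Prop :=
  IsFibrational (X := X ⨯ Y) (fun _ p => E (p ≫ prod.fst) (p ≫ prod.snd))

namespace IsFibRel

variable {X Y : C} {E : ∀ ⦃T : C⦄, (T ⟶ X) → (T ⟶ Y) → Prop}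

theorem comap (hE : IsFibRel E) {Z : C} (f : Z ⟶ X) (g : Z ⟶ Y) :
    IsFibrational (fun T (p : T ⟶ Z) => E (p ≫ f) (p ≫ g)) :=
  (IsFibrational.comap hE (prod.lift f g)).congr (by simp)

theorem map (hE : IsFibRel E) {X' Y' : C} (f : X' ⟶ X) (g : Y' ⟶ Y) :
    IsFibRel (fun T (u : T ⟶ X') (v : T ⟶ Y') => E (u ≫ f) (v ≫ g)) :=
  (hE.comap (prod.fst ≫ f) (prod.snd ≫ g)).congr (by simp)

theorem swap (hE : IsFibRel E) : IsFibRel (fun T (u : T ⟶ Y) (v : T ⟶ X) => E v u) :=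
  hE.comap prod.snd prod.fst

theorem and {E' : ∀ ⦃T : C⦄, (T ⟶ X) → (T ⟶ Y) → Prop} (hE : IsFibRel E) (hE' : IsFibRel E') :
    IsFibRel (fun T (u : T ⟶ X) (v : T ⟶ Y) => E u v ∧ E' u v) :=
  IsFibrational.and hE hE'

/-- The witness is quantified away along the projection forgetting `X`, a fibration since every
object is fibrant. -/
theorem exists_middle {Z : C} {E' : ∀ ⦃T : C⦄, (T ⟶ X) → (T ⟶ Z) → Prop} (hE : IsFibRel E)
    (hE' : IsFibRel E') :
    IsFibRel (fun T (u : T ⟶ Y) (v : T ⟶ Z) => ∃ w : T ⟶ X, E w u ∧ E' w v) := by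
  have h := ((hE.comap (Z := (Y ⨯ Z) ⨯ X) prod.snd (prod.fst ≫ prod.fst)).and
    (hE'.comap prod.snd (prod.fst ≫ prod.snd))).exists_along (fib_fst (Y ⨯ Z) X)
  refine IsFibrational.congr h fun T f => ⟨?_, ?_⟩
  · rintro ⟨f', rfl, h₁, h₂⟩
    exact ⟨f' ≫ prod.snd, by simpa using h₁, by simpa using h₂⟩
  · rintro ⟨w, h₁, h₂⟩
    exact ⟨prod.lift f w, by simp, by simpa using h₁, by simpa using h₂⟩

theorem precomp (hE : IsFibRel E) {T T' : C} (w : T' ⟶ T) {f : T ⟶ X} {g : T ⟶ Y} (h : E f g) :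
    E (w ≫ f) (w ≫ g) := by
  simpa using (hE.comap f g).precomp w (f := 𝟙 T) (by simpa using h)

theorem of_weq (hE : IsFibRel E) {T T' : C} {w : T' ⟶ T} (hw : weakEquivalences C w)
    {f : T ⟶ X} {g : T ⟶ Y} (h : E (w ≫ f) (w ≫ g)) : E f g := by
  simpa using (hE.comap f g).of_weq hw (f := 𝟙 T) (by simpa using h)

/-- Fibrational relations are invariant under homotopy. -/
theorem trans_homotopic (hE : IsFibRel E) {T : C} {u : T ⟶ X} {v v' : T ⟶ Y} (h : E u v)
    (hv : Homotopic v v') : E u v' := by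
  obtain ⟨P, hP, k, rfl, rfl⟩ := hv
  obtain ⟨R, ρ, hρ, hR⟩ := hE.map (𝟙 X) (𝟙 Y)
  simp only [Category.comp_id] at hR
  -- The universal case: a related pair together with a path starting at its second component.
  -- Adjoining the constant path is a section `w` of the acyclic fibration `q`, hence a weak
  -- equivalence, so the claim need only be checked on constant paths.
  obtain ⟨R', q, e, hpb⟩ : ∃ (R' : C) (q : R' ⟶ R) (e : R' ⟶ P.P),
      IsPullback q e (ρ ≫ prod.snd) P.p₀ := by
    obtain ⟨R', q, e, h, -⟩ := exists_isPullback (trivFib_p₀ P hP).1 (ρ ≫ prod.snd)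
    exact ⟨R', q, e, h⟩
  let w : R ⟶ R' := hpb.lift (𝟙 R) (ρ ≫ prod.snd ≫ P.ι) (by simp)
  have hwq : w ≫ q = 𝟙 R := hpb.lift_fst _ _ _
  have hwe : w ≫ e = ρ ≫ prod.snd ≫ P.ι := hpb.lift_snd _ _ _
  have hw : weakEquivalences C w :=
    weq_of_section (trivFib_of_isPullback hpb (trivFib_p₀ P hP)).2 hwq
  have key : E (q ≫ ρ ≫ prod.fst) (e ≫ P.p₁) := by
    refine hE.of_weq hw ?_
    rw [reassoc_of% hwq, reassoc_of% hwe, P.ι_p₁, Category.comp_id]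
    exact (hR ρ).2 ⟨𝟙 R, by simp⟩
  obtain ⟨H, hH⟩ := (hR (prod.lift u (k ≫ P.p₀))).1 (by simpa using h)
  have := hE.precomp (hpb.lift H k (by rw [reassoc_of% hH]; simp)) key
  rw [hpb.lift_fst_assoc, hpb.lift_snd_assoc, reassoc_of% hH] at this
  simpa using this

/-- Path induction. -/
theorem of_homotopic {E : ∀ ⦃T : C⦄, (T ⟶ X) → (T ⟶ X) → Prop} (hE : IsFibRel E)
    (h : E (𝟙 X) (𝟙 X)) {T : C} {u v : T ⟶ X} (huv : Homotopic u v) : E u v :=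
  hE.trans_homotopic (by simpa using hE.precomp u h) huv

end IsFibRel

/-! ### The homotopy relation -/

/-- Independence of the path object: the weak equivalence `P'.ι` lifts against the fibration `P.p`,
giving a map from any path object to `P` over `X ⨯ X`. -/
theorem homotopic_iff {X : C} (P : PathObject X) (hP : P.IsGood) {T : C} (f : T ⟶ X ⨯ X) :
    Homotopic (f ≫ prod.fst) (f ≫ prod.snd) ↔ ∃ H : T ⟶ P.P, H ≫ P.p = f := by
  constructor
  · rintro ⟨P', hP', k, h₀, h₁⟩
    obtain ⟨K, hK⟩ := exists_lift_of_weq ((fibration_iff _).1 hP.fibration_p)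
      ((weakEquivalence_iff _).1 P'.weakEquivalence_ι) P'.p P.ι (by ext <;> simp)
    refine ⟨k ≫ K, ?_⟩
    rw [Category.assoc, hK]
    ext <;> simp [h₀, h₁]
  · rintro ⟨H, rfl⟩
    exact ⟨P, hP, H, by simp, by simp⟩

/-- Makes path induction applicable to homotopy itself; symmetry, transitivity and postcomposition
follow. -/
theorem homotopic_isFibRel (X : C) : IsFibRel (X := X) (Y := X) (fun _ u v => Homotopic u v) := by
  obtain ⟨P, hP⟩ := PathCategory.exists_pathObject X
  exact ⟨P.P, P.p, (fibration_iff _).1 hP.fibration_p, fun T f => homotopic_iff P hP f⟩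

namespace Homotopic

variable {X Y T : C}

theorem refl (f : T ⟶ X) : Homotopic f f := by
  obtain ⟨P, hP⟩ := PathCategory.exists_pathObject X
  exact ⟨P, hP, f ≫ P.ι, by simp, by simp⟩

theorem symm {f g : T ⟶ X} (h : Homotopic f g) : Homotopic g f :=
  (homotopic_isFibRel X).swap.of_homotopic (refl _) h

theorem trans {f g h : T ⟶ X} (h₁ : Homotopic f g) (h₂ : Homotopic g h) : Homotopic f h :=
  (homotopic_isFibRel X).trans_homotopic h₁ h₂

theorem precomp {T' : C} (w : T' ⟶ T) {f g : T ⟶ X} (h : Homotopic f g) :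
    Homotopic (w ≫ f) (w ≫ g) :=
  (homotopic_isFibRel X).precomp w h

theorem postcomp {f g : T ⟶ X} (h : Homotopic f g) (k : X ⟶ Y) : Homotopic (f ≫ k) (g ≫ k) :=
  ((homotopic_isFibRel Y).map k k).of_homotopic (refl _) h

end Homotopic

theorem IsFibrational.of_homotopic {X : C} {Q : ∀ ⦃T : C⦄, (T ⟶ X) → Prop}
    (hQ : IsFibrational Q) {T : C} {f g : T ⟶ X} (hf : Q f) (h : Homotopic f g) : Q g :=
  IsFibRel.trans_homotopic (X := X) (Y := X) (E := fun _ _ v => Q v) (hQ.comap prod.snd) (u := f)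
    hf h

theorem IsFibRel.homotopic_trans {X Y : C} {E : ∀ ⦃T : C⦄, (T ⟶ X) → (T ⟶ Y) → Prop}
    (hE : IsFibRel E) {T : C} {u u' : T ⟶ X} {v : T ⟶ Y} (hu : Homotopic u u') (h : E u' v) :
    E u v :=
  hE.swap.trans_homotopic h hu.symm

/-- The homotopy `f ≫ s ≃ 𝟙` may be checked after precomposing with the weak equivalence `s`, where
it is an equality. -/
theorem isHomotopyEquivalence_of_section {X Y : C} {s : Y ⟶ X} {f : X ⟶ Y}
    (hf : weakEquivalences C f) (h : s ≫ f = 𝟙 Y) : IsHomotopyEquivalence s := by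
  refine ⟨f, h ▸ Homotopic.refl _, ?_⟩
  refine (homotopic_isFibRel X).of_weq (weq_of_section hf h) ?_
  rw [reassoc_of% h, Category.comp_id]
  exact .refl _

theorem IsHomotopyEquivalence.weq {X Y : C} {f : X ⟶ Y} (hf : IsHomotopyEquivalence f) :
    weakEquivalences C f := by
  -- The homotopy is a section of the acyclic fibration `P.p₀`, so `k` is a composite of two weak
  -- equivalences. The lemma then follows from 2-out-of-6 for `f`, `g`, `f`.
  have key : ∀ {Z : C} {k : Z ⟶ Z}, Homotopic k (𝟙 Z) → weakEquivalences C k := by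
    rintro Z k hk
    obtain ⟨P, hP, h, h₀, h₁⟩ := hk.symm
    have hh : weakEquivalences C h := weq_of_section (trivFib_p₀ P hP).2 h₀
    have hp : weakEquivalences C P.p₁ :=
      weq_of_comp_left ((weakEquivalence_iff _).1 P.weakEquivalence_ι) (P.ι_p₁ ▸ weq_isIso (𝟙 Z))
    rw [← h₁]
    simpa using (PrePathCategory.two_out_of_six h (𝟙 _) P.p₁ (by simpa using hh)
      (by simpa using hp)).2.2.2
  obtain ⟨g, h₁, h₂⟩ := hf
  exact (PrePathCategory.two_out_of_six f g f (key h₁) (key h₂)).1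

/-! ### Homotopy pullbacks -/

/-- The canonical homotopy pullback. -/
theorem exists_isHomotopyPullback {A B S : C} (i : A ⟶ S) (x : B ⟶ S) :
    ∃ (W : C) (a : W ⟶ A) (b : W ⟶ B), IsHomotopyPullback a b i x ∧
      Homotopic (a ≫ i) (b ≫ x) ∧
        ∀ ⦃T : C⦄ (u : T ⟶ A) (v : T ⟶ B), Homotopic (u ≫ i) (v ≫ x) →
          ∃ w : T ⟶ W, w ≫ a = u ∧ w ≫ b = v := by
  obtain ⟨P, hP⟩ := PathCategory.exists_pathObject S
  obtain ⟨W, w, k, h, hw⟩ := exists_isPullback ((fibration_iff _).1 hP.fibration_p)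
    (prod.map i x)
  refine ⟨W, w ≫ prod.fst, w ≫ prod.snd, ⟨P, hP, W, w, k, h, 𝟙 W,
    ⟨𝟙 W, by simpa using Homotopic.refl _, by simpa using Homotopic.refl _⟩, by simp, by simp⟩,
    ?_, fun T u v huv => ?_⟩
  · have := (homotopic_iff P hP (w ≫ prod.map i x)).2 ⟨k, h.w.symm⟩
    simpa using this
  · obtain ⟨H, hH⟩ := (homotopic_iff P hP (prod.lift (u ≫ i) (v ≫ x))).1 (by simpa using huv)
    refine ⟨h.lift (prod.lift u v) H (by rw [hH]; simp), ?_, ?_⟩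
    · rw [h.lift_fst_assoc, prod.lift_fst]
    · rw [h.lift_fst_assoc, prod.lift_snd]

/-- The bare existence of a map suffices, since it is used only with `D` homotopy initial. -/
theorem IsHomotopyPullback.exists_lift {D A B S : C} {a : D ⟶ A} {b : D ⟶ B} {i : A ⟶ S}
    {x : B ⟶ S} (h : IsHomotopyPullback a b i x) {T : C} (u : T ⟶ A) (v : T ⟶ B)
    (huv : Homotopic (u ≫ i) (v ≫ x)) : Nonempty (T ⟶ D) := by
  obtain ⟨P, hP, W, w, k, hW, -, ⟨g, -⟩, -⟩ := h
  obtain ⟨H, hH⟩ := (homotopic_iff P hP (prod.lift (u ≫ i) (v ≫ x))).1 (by simpa using huv)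
  exact ⟨hW.lift (prod.lift u v) H (by rw [hH]; simp) ≫ g⟩

/-- A homotopy equivalence `i` has the identity as a homotopy pullback along any `x` lifting to
its domain. -/
theorem IsHomotopyEquivalence.isHomotopyPullback {A B S : C} {i : A ⟶ S}
    (hi : IsHomotopyEquivalence i) (z : B ⟶ A) (x : B ⟶ S) (hx : Homotopic (z ≫ i) x) :
    IsHomotopyPullback z (𝟙 B) i x := by
  obtain ⟨P, hP⟩ := PathCategory.exists_pathObject S
  obtain ⟨M, m, k, s, hM, hm, hs, hsm⟩ := exists_mappingPath i P hP
  -- `W` is also the pullback along `x` of the acyclic fibration `M ⟶ S`, so the section `B ⟶ W`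
  -- induced by `z` and the homotopy is a homotopy equivalence.
  obtain ⟨W, w, e, hW, hw⟩ := exists_isPullback hm (prod.map (𝟙 A) x)
  have hsm' : s ≫ m ≫ prod.snd = i := by rw [reassoc_of% hsm, prod.lift_snd]
  have hm' : trivialFibrations C (m ≫ prod.snd) :=
    ⟨fib_comp' hm (fib_snd _ _), weq_of_comp_left hs (hsm' ▸ hi.weq)⟩
  have h₁ : IsPullback (w ≫ prod.snd) e x (m ≫ prod.snd) :=
    (hW.flip.paste_vert (isPullback_snd_map (𝟙 A) x).flip).flip
  have h₂ : IsPullback w (e ≫ k) (prod.map i x) P.p := by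
    simpa using hW.paste_vert hM
  obtain ⟨H, hH⟩ := (homotopic_iff P hP (prod.lift (z ≫ i) x)).1 (by simpa using hx)
  have hl : prod.lift z (𝟙 B) ≫ prod.map i x = H ≫ P.p := by rw [hH]; simp
  exact ⟨P, hP, W, w, e ≫ k, h₂, h₂.lift _ _ hl,
    isHomotopyEquivalence_of_section (trivFib_of_isPullback h₁ hm').2
      (by rw [h₂.lift_fst_assoc, prod.lift_snd]),
    by rw [h₂.lift_fst_assoc, prod.lift_fst], by rw [h₂.lift_fst_assoc, prod.lift_snd]⟩

/-! ### Homotopy sums -/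

section Sums

variable {A B S : C} {i : A ⟶ S} {j : B ⟶ S}

theorem IsHomotopySum.symm (h : IsHomotopySum i j) : IsHomotopySum j i := fun X f g => by
  obtain ⟨k, hk, hk'⟩ := h X g f
  exact ⟨k, hk.symm, fun k' h₁ h₂ => hk' k' h₂ h₁⟩

/-- Fibrational predicates may be checked on the two summands of a homotopy sum. -/
theorem IsFibrational.of_sum {X : C} {Q : ∀ ⦃T : C⦄, (T ⟶ X) → Prop} (hQ : IsFibrational Q)
    (h : IsHomotopySum i j) {f : S ⟶ X} (h₁ : Q (i ≫ f)) (h₂ : Q (j ≫ f)) : Q f := by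
  have hQ' := hQ
  obtain ⟨R, ρ, hρ, hR⟩ := hQ
  obtain ⟨H, hH⟩ := (hR _).1 h₁
  obtain ⟨K, hK⟩ := (hR _).1 h₂
  obtain ⟨L, ⟨hL₁, hL₂⟩, -⟩ := h R H K
  obtain ⟨m, -, hm⟩ := h X (i ≫ f) (j ≫ f)
  -- The glued map `L` covers `f` only up to homotopy, by uniqueness of maps out of the sum;
  -- homotopy invariance then suffices.
  have hL : Homotopic (L ≫ ρ) f :=
    (hm (L ≫ ρ) (by simpa [hH] using hL₁.postcomp ρ) (by simpa [hK] using hL₂.postcomp ρ)).trans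
      (hm f (.refl _) (.refl _)).symm
  exact hQ'.of_homotopic ((hR _).2 ⟨L, rfl⟩) hL

theorem IsFibRel.of_sum {X Y : C} {E : ∀ ⦃T : C⦄, (T ⟶ X) → (T ⟶ Y) → Prop} (hE : IsFibRel E)
    (h : IsHomotopySum i j) {u : S ⟶ X} {v : S ⟶ Y} (h₁ : E (i ≫ u) (i ≫ v))
    (h₂ : E (j ≫ u) (j ≫ v)) : E u v := by
  simpa using (hE.comap u v).of_sum h (f := 𝟙 S) (by simpa using h₁) (by simpa using h₂)

theorem Homotopic.of_sum {X : C} (h : IsHomotopySum i j) {u v : S ⟶ X}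
    (h₁ : Homotopic (i ≫ u) (i ≫ v)) (h₂ : Homotopic (j ≫ u) (j ≫ v)) : Homotopic u v :=
  (homotopic_isFibRel X).of_sum h h₁ h₂

theorem IsHomotopyInitial.homotopic {Z X : C} (hZ : IsHomotopyInitial Z) (f g : Z ⟶ X) :
    Homotopic f g := by
  obtain ⟨k, hk⟩ := hZ X
  exact (hk f).trans (hk g).symm

theorem IsFibrational.of_initial {X : C} {Q : ∀ ⦃T : C⦄, (T ⟶ X) → Prop} (hQ : IsFibrational Q)
    {Z : C} (hZ : IsHomotopyInitial Z) (f : Z ⟶ X) : Q f := by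
  have hQ' := hQ
  obtain ⟨R, ρ, hρ, hR⟩ := hQ
  obtain ⟨k, -⟩ := hZ R
  exact hQ'.of_homotopic ((hR _).2 ⟨k, rfl⟩) (hZ.homotopic _ _)

theorem IsFibRel.of_initial {X Y : C} {E : ∀ ⦃T : C⦄, (T ⟶ X) → (T ⟶ Y) → Prop}
    (hE : IsFibRel E) {Z : C} (hZ : IsHomotopyInitial Z) (u : Z ⟶ X) (v : Z ⟶ Y) : E u v := by
  simpa using (hE.comap u v).of_initial hZ (𝟙 Z)

theorem IsHomotopyInitial.of_sum (h : IsHomotopySum i j) (hA : IsHomotopyInitial A)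
    (hB : IsHomotopyInitial B) : IsHomotopyInitial S := fun X => by
  obtain ⟨f, -⟩ := hA X
  obtain ⟨g, -⟩ := hB X
  obtain ⟨k, -⟩ := h X f g
  exact ⟨k, fun g => .of_sum h (hA.homotopic _ _) (hB.homotopic _ _)⟩

/-- Homotopy initial objects are strict in a homotopy extensive path category. -/
theorem IsHomotopyInitial.of_hom (hC : IsHomotopyExtensive C) {Z T : C}
    (hZ : IsHomotopyInitial Z) (z : T ⟶ Z) : IsHomotopyInitial T := by
  -- The sum of `Z` with itself is again initial, so both injections are homotopy equivalences.
  -- Stability makes `T`, with two identity maps, a homotopy sum of `T` and `T`, which forces any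
  -- two maps out of `T` to be homotopic.
  obtain ⟨S, i, j, hS, hst, -⟩ := hC.exists_sum Z Z
  have equiv : ∀ (i : Z ⟶ S), IsHomotopyEquivalence i := fun i => by
    obtain ⟨r, -⟩ := hZ.of_sum hS hZ Z
    exact ⟨r, hZ.homotopic _ _, (hZ.of_sum hS hZ).homotopic _ _⟩
  have hT := hst (𝟙 T) (𝟙 T) z (z ≫ i) z ((equiv i).isHomotopyPullback _ _ (.refl _))
    ((equiv j).isHomotopyPullback _ _ ((hZ.homotopic j i).precomp z))
  intro X
  obtain ⟨f, -⟩ := hZ X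
  refine ⟨z ≫ f, fun g => ?_⟩
  obtain ⟨h, ⟨h₁, h₂⟩, -⟩ := hT X g (z ≫ f)
  exact h₁.symm.trans h₂

/-- Homotopy extensivity gives stability and disjointness for one chosen sum; this comparison
transfers their consequences to every sum. -/
theorem IsHomotopySum.exists_comparison {S' : C} {i' : A ⟶ S'} {j' : B ⟶ S'}
    (h : IsHomotopySum i j) (h' : IsHomotopySum i' j') :
    ∃ (e : S ⟶ S') (e' : S' ⟶ S), Homotopic (i ≫ e) i' ∧ Homotopic (j ≫ e) j' ∧
      Homotopic (i' ≫ e') i ∧ Homotopic (j' ≫ e') j ∧ Homotopic (e ≫ e') (𝟙 S) := by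
  obtain ⟨e, ⟨h₁, h₂⟩, -⟩ := h _ i' j'
  obtain ⟨e', ⟨h₁', h₂'⟩, -⟩ := h' _ i j
  refine ⟨e, e', h₁, h₂, h₁', h₂', .of_sum h ?_ ?_⟩
  · simpa using (h₁.postcomp e').trans h₁'
  · simpa using (h₂.postcomp e').trans h₂'

/-- In a homotopy extensive path category any map into a homotopy sum splits. -/
theorem IsHomotopySum.exists_split (hC : IsHomotopyExtensive C) (h : IsHomotopySum i j) {T : C}
    (x : T ⟶ S) : ∃ (D E : C) (k : D ⟶ T) (l : E ⟶ T) (a : D ⟶ A) (b : E ⟶ B),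
      IsHomotopySum k l ∧ Homotopic (k ≫ x) (a ≫ i) ∧ Homotopic (l ≫ x) (b ≫ j) := by
  obtain ⟨S', i', j', h', hst, -⟩ := hC.exists_sum A B
  obtain ⟨e, e', -, -, h₁, h₂, he⟩ := h.exists_comparison h'
  obtain ⟨D, a, k, hD, hak, -⟩ := exists_isHomotopyPullback i' (x ≫ e)
  obtain ⟨E, b, l, hE, hbl, -⟩ := exists_isHomotopyPullback j' (x ≫ e)
  refine ⟨D, E, k, l, a, b, hst _ _ _ _ _ hD hE, ?_, ?_⟩
  · have h₃ : Homotopic (k ≫ x ≫ e ≫ e') (k ≫ x) := by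
      simpa using (he.precomp x).precomp k
    have h₄ : Homotopic (a ≫ i' ≫ e') (k ≫ x ≫ e ≫ e') := by simpa using hak.postcomp e'
    exact ((h₁.precomp a).symm.trans (h₄.trans h₃)).symm
  · have h₃ : Homotopic (l ≫ x ≫ e ≫ e') (l ≫ x) := by
      simpa using (he.precomp x).precomp l
    have h₄ : Homotopic (b ≫ j' ≫ e') (l ≫ x ≫ e ≫ e') := by simpa using hbl.postcomp e'
    exact ((h₂.precomp b).symm.trans (h₄.trans h₃)).symm

theorem IsHomotopySum.disjoint (hC : IsHomotopyExtensive C) (h : IsHomotopySum i j) {T : C}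
    {u : T ⟶ A} {v : T ⟶ B} (huv : Homotopic (u ≫ i) (v ≫ j)) : IsHomotopyInitial T := by
  obtain ⟨S', i', j', h', -, Z, a, b, hZ, hpb⟩ := hC.exists_sum A B
  obtain ⟨e, e', h₁, h₂, -⟩ := h.exists_comparison h'
  have huv' : Homotopic (u ≫ i ≫ e) (v ≫ j ≫ e) := by simpa using huv.postcomp e
  obtain ⟨t⟩ := hpb.exists_lift u v
    ((h₁.precomp u).symm.trans (huv'.trans (h₂.precomp v)))
  exact hZ.of_hom hC t

/-- In a homotopy extensive path category the injections of a homotopy sum are monomorphisms up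
to homotopy. -/
theorem IsHomotopySum.mono (hC : IsHomotopyExtensive C) (h : IsHomotopySum i j) {T : C}
    {u v : T ⟶ A} (huv : Homotopic (u ≫ i) (v ≫ i)) : Homotopic u v := by
  obtain ⟨S', i', j', h', hst, -⟩ := hC.exists_sum A B
  obtain ⟨e, e', h₁, h₂, -⟩ := h.exists_comparison h'
  -- Pulling back along `i'` writes `A` as the sum of the self-intersection `D` and the initial
  -- object `E`. So `k` has a homotopy retraction `s`; the diagonal `δ` is homotopic to `s`, whence
  -- `k ≃ a`: the two projections of `D` agree.
  obtain ⟨D, a, k, hD, -, hlift⟩ := exists_isHomotopyPullback i' i'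
  obtain ⟨E, b, l, hE, hbl, -⟩ := exists_isHomotopyPullback j' i'
  have hkl := hst _ _ _ _ _ hD hE
  have hE₀ : IsHomotopyInitial E := h'.disjoint hC hbl.symm
  obtain ⟨s, ⟨hs, -⟩, -⟩ := hkl D (𝟙 D) (hE₀ D).choose
  obtain ⟨δ, hδa, hδk⟩ := hlift (𝟙 A) (𝟙 A) (.refl _)
  have hδs : Homotopic δ s := by simpa [reassoc_of% hδk] using (hs.precomp δ).symm
  have hkδ : Homotopic (k ≫ δ) (𝟙 D) := (hδs.precomp k).trans hs
  have hka : Homotopic k a := by simpa [hδa] using hkδ.postcomp a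
  have huv' : Homotopic (u ≫ i ≫ e) (v ≫ i ≫ e) := by simpa using huv.postcomp e
  obtain ⟨w, rfl, rfl⟩ := hlift u v ((h₁.precomp u).symm.trans (huv'.trans (h₁.precomp v)))
  exact hka.symm.precomp w

end Sums

namespace Hex

/-! ### The homotopy exact completion via generalised elements -/

/-- The relation on maps into `A.X` given by the homotopy equivalence relation `A.ρ`. -/
def Eqv (A : Hex C) ⦃T : C⦄ (u v : T ⟶ A.X) : Prop :=
  ∃ H : T ⟶ A.R, H ≫ A.ρ = prod.lift u v

theorem eqv_isFibRel (A : Hex C) : IsFibRel A.Eqv := by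
  refine ⟨A.R, A.ρ, A.isEquivRel.fib, fun T f => ?_⟩
  have : prod.lift (f ≫ prod.fst) (f ≫ prod.snd) = f := by ext <;> simp
  simp only [Eqv, this]

theorem Eqv.refl {A : Hex C} {T : C} (u : T ⟶ A.X) : A.Eqv u u := by
  obtain ⟨r, hr⟩ := A.isEquivRel.refl
  refine ⟨u ≫ r, ?_⟩
  rw [Category.assoc, hr]
  ext <;> simp

theorem Eqv.symm {A : Hex C} {T : C} {u v : T ⟶ A.X} (h : A.Eqv u v) : A.Eqv v u := by
  obtain ⟨H, hH⟩ := h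
  obtain ⟨s, h₁, h₂⟩ := A.isEquivRel.symm
  refine ⟨H ≫ s, ?_⟩
  ext
  · simp [h₁, reassoc_of% hH]
  · simp [h₂, reassoc_of% hH]

theorem Eqv.trans {A : Hex C} {T : C} {u v w : T ⟶ A.X} (h : A.Eqv u v) (h' : A.Eqv v w) :
    A.Eqv u w := by
  obtain ⟨H, hH⟩ := h
  obtain ⟨K, hK⟩ := h'
  have := A.isEquivRel.hasPullback
  obtain ⟨t, h₁, h₂⟩ := A.isEquivRel.trans _ _ (IsPullback.of_hasPullback _ _)
  have e : H ≫ A.ρ ≫ prod.snd = K ≫ A.ρ ≫ prod.fst := by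
    simp [reassoc_of% hH, reassoc_of% hK]
  refine ⟨pullback.lift H K e ≫ t, ?_⟩
  ext
  · rw [Category.assoc, Category.assoc, h₁, pullback.lift_fst_assoc, reassoc_of% hH,
      prod.lift_fst, prod.lift_fst]
  · rw [Category.assoc, Category.assoc, h₂, pullback.lift_snd_assoc, reassoc_of% hK,
      prod.lift_snd, prod.lift_snd]

theorem Eqv.precomp {A : Hex C} {T T' : C} (w : T' ⟶ T) {u v : T ⟶ A.X} (h : A.Eqv u v) :
    A.Eqv (w ≫ u) (w ≫ v) :=
  A.eqv_isFibRel.precomp w h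

theorem _root_.PathCat.Homotopic.eqv {A : Hex C} {T : C} {u v : T ⟶ A.X} (h : Homotopic u v) :
    A.Eqv u v :=
  A.eqv_isFibRel.of_homotopic (Eqv.refl _) h

theorem Eqv.of_sum {A : Hex C} {D E T : C} {k : D ⟶ T} {l : E ⟶ T} (h : IsHomotopySum k l)
    {u v : T ⟶ A.X} (h₁ : A.Eqv (k ≫ u) (k ≫ v)) (h₂ : A.Eqv (l ≫ u) (l ≫ v)) : A.Eqv u v :=
  A.eqv_isFibRel.of_sum h h₁ h₂

theorem Eqv.of_initial {A : Hex C} {T : C} (h : IsHomotopyInitial T) (u v : T ⟶ A.X) :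
    A.Eqv u v :=
  A.eqv_isFibRel.of_initial h u v

/-- A Yoneda argument: symmetry comes from the universal related pair `ρ`, transitivity from the
universal composable pairs. -/
theorem isHomotopyEquivRel_of_equivalence {X R : C} {E : ∀ ⦃T : C⦄, (T ⟶ X) → (T ⟶ X) → Prop}
    (hE : ∀ T : C, Equivalence (@E T)) {ρ : R ⟶ X ⨯ X} (hρ : fibrations C ρ)
    (hR : ∀ ⦃T : C⦄ (f : T ⟶ X ⨯ X), E (f ≫ prod.fst) (f ≫ prod.snd) ↔ ∃ H : T ⟶ R, H ≫ ρ = f) :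
    IsHomotopyEquivRel ρ where
  fib := hρ
  refl := (hR _).1 (by simpa using (hE _).refl _)
  symm := by
    obtain ⟨H, hH⟩ := (hR (prod.lift (ρ ≫ prod.snd) (ρ ≫ prod.fst))).1
      (by simpa using (hE _).symm ((hR ρ).2 ⟨𝟙 R, by simp⟩))
    exact ⟨H, by simp [reassoc_of% hH], by simp [reassoc_of% hH]⟩
  trans := by
    intro T q₁ q₂ h
    have h₁ := (hR (q₁ ≫ ρ)).2 ⟨q₁, rfl⟩
    have h₂ := (hR (q₂ ≫ ρ)).2 ⟨q₂, rfl⟩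
    simp only [Category.assoc] at h₁ h₂
    rw [h.w] at h₁
    obtain ⟨H, hH⟩ := (hR (prod.lift (q₁ ≫ ρ ≫ prod.fst) (q₂ ≫ ρ ≫ prod.snd))).1
      (by simpa using (hE _).trans h₁ h₂)
    exact ⟨H, by simp [reassoc_of% hH], by simp [reassoc_of% hH]⟩

/-- The object of `Hex C` given by a fibrational relation which is an equivalence relation on
generalised elements. -/
noncomputable abbrev of (X : C) (E : ∀ ⦃T : C⦄, (T ⟶ X) → (T ⟶ X) → Prop) (hE : IsFibRel E)
    (hE' : ∀ T : C, Equivalence (@E T)) : Hex C where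
  X := X
  R := hE.choose
  ρ := hE.choose_spec.choose
  isEquivRel := isHomotopyEquivRel_of_equivalence hE' hE.choose_spec.choose_spec.1
    hE.choose_spec.choose_spec.2

theorem of_eqv {X : C} {E : ∀ ⦃T : C⦄, (T ⟶ X) → (T ⟶ X) → Prop} (hE : IsFibRel E)
    (hE' : ∀ T : C, Equivalence (@E T)) {T : C} {u v : T ⟶ X} :
    (of X E hE hE').Eqv u v ↔ E u v := by
  have := hE.choose_spec.choose_spec.2 (prod.lift u v)
  simp only [prod.lift_fst, prod.lift_snd] at this
  exact this.symm

/-- The morphism of `Hex C` represented by a map which respects the relations. -/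
def homMk {A B : Hex C} (f : A.X ⟶ B.X)
    (hf : ∀ ⦃T : C⦄ (u v : T ⟶ A.X), A.Eqv u v → B.Eqv (u ≫ f) (v ≫ f)) : A ⟶ B :=
  Quotient.mk _ ⟨f, by
    obtain ⟨φ, hφ⟩ := hf (A.ρ ≫ prod.fst) (A.ρ ≫ prod.snd)
      ⟨𝟙 _, by ext <;> simp⟩
    exact ⟨φ, by rw [hφ]; ext <;> simp⟩⟩

theorem exists_homMk {A B : Hex C} (φ : A ⟶ B) : ∃ f hf, φ = homMk f hf := by
  obtain ⟨⟨f, φ, hφ⟩⟩ := φ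
  refine ⟨f, fun T u v => ?_, rfl⟩
  rintro ⟨H, hH⟩
  refine ⟨H ≫ φ, ?_⟩
  rw [Category.assoc, hφ, reassoc_of% hH]
  ext <;> simp

theorem homMk_eq_iff {A B : Hex C} {f g : A.X ⟶ B.X} {hf hg} :
    (homMk f hf : A ⟶ B) = homMk g hg ↔ B.Eqv f g :=
  Quotient.eq (r := homSetoid A B)

theorem homMk_comp {A B D : Hex C} {f : A.X ⟶ B.X} {g : B.X ⟶ D.X} {hf hg} :
    (homMk f hf : A ⟶ B) ≫ (homMk g hg : B ⟶ D) =
      homMk (f ≫ g) (fun _ u v h => by simpa using hg _ _ (hf _ _ h)) := rfl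

theorem homMk_comp_eq_iff {A B D : Hex C} {f : A.X ⟶ B.X} {g : B.X ⟶ D.X} {k : A.X ⟶ D.X}
    {hf hg hk} :
    (homMk f hf : A ⟶ B) ≫ (homMk g hg : B ⟶ D) = homMk k hk ↔ D.Eqv (f ≫ g) k := by
  rw [homMk_comp, homMk_eq_iff]

theorem homMk_comp_eq_id_iff {A B : Hex C} {f : A.X ⟶ B.X} {g : B.X ⟶ A.X} {hf hg} :
    (homMk f hf : A ⟶ B) ≫ (homMk g hg : B ⟶ A) = 𝟙 A ↔ A.Eqv (f ≫ g) (𝟙 A.X) :=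
  homMk_comp_eq_iff (k := 𝟙 A.X) (hk := by simp)

theorem homMk_comp_eq_comp_iff {A B B' D : Hex C} {f : A.X ⟶ B.X} {g : B.X ⟶ D.X}
    {f' : A.X ⟶ B'.X} {g' : B'.X ⟶ D.X} {hf hg hf' hg'} :
    (homMk f hf : A ⟶ B) ≫ (homMk g hg : B ⟶ D) = (homMk f' hf' : A ⟶ B') ≫ homMk g' hg' ↔
      D.Eqv (f ≫ g) (f' ≫ g') := by
  rw [homMk_comp, homMk_comp, homMk_eq_iff]

/-- The image of an object of `C` in its homotopy exact completion. -/
noncomputable abbrev y (T : C) : Hex C :=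
  of T (fun _ u v => Homotopic u v) (homotopic_isFibRel T)
    (fun _ => ⟨.refl, .symm, .trans⟩)

/-- Generalised elements as morphisms of `Hex C`. -/
noncomputable def pt {A : Hex C} {T : C} (u : T ⟶ A.X) : y T ⟶ A :=
  homMk (A := y T) u fun _ _ _ h => (((of_eqv _ _).1 h).postcomp u).eqv

theorem pt_eq_iff {A : Hex C} {T : C} {u v : T ⟶ A.X} : pt u = pt v ↔ A.Eqv u v := homMk_eq_iff

theorem pt_comp {A B : Hex C} {T : C} (u : T ⟶ A.X) {f : A.X ⟶ B.X} {hf} :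
    pt u ≫ (homMk f hf : A ⟶ B) = pt (u ≫ f) := rfl

theorem exists_pt {A : Hex C} {T : C} (φ : y T ⟶ A) : ∃ u, φ = pt u := by
  obtain ⟨u, hu, rfl⟩ := exists_homMk φ
  exact ⟨u, rfl⟩

/-- Pullback squares in `Hex C` are detected by generalised elements. -/
theorem isPullback_iff {W A B D : Hex C} {p : W.X ⟶ A.X} {q : W.X ⟶ B.X} {f : A.X ⟶ D.X}
    {g : B.X ⟶ D.X} {hp hq hf hg} :
    IsPullback (homMk p hp : W ⟶ A) (homMk q hq : W ⟶ B) (homMk f hf : A ⟶ D)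
      (homMk g hg : B ⟶ D) ↔
      D.Eqv (p ≫ f) (q ≫ g) ∧
      (∀ ⦃T : C⦄ (u : T ⟶ A.X) (v : T ⟶ B.X), D.Eqv (u ≫ f) (v ≫ g) →
        ∃ w : T ⟶ W.X, A.Eqv (w ≫ p) u ∧ B.Eqv (w ≫ q) v) ∧
      (∀ ⦃T : C⦄ (w w' : T ⟶ W.X), A.Eqv (w ≫ p) (w' ≫ p) → B.Eqv (w ≫ q) (w' ≫ q) →
        W.Eqv w w') := by
  constructor
  · intro h
    refine ⟨homMk_comp_eq_comp_iff.1 h.w, fun T u v huv => ?_, fun T w w' h₁ h₂ => ?_⟩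
    · have e : pt u ≫ (homMk f hf : A ⟶ D) = pt v ≫ (homMk g hg : B ⟶ D) := pt_eq_iff.2 huv
      obtain ⟨w, hw⟩ := exists_pt (h.lift _ _ e)
      refine ⟨w, pt_eq_iff.1 ?_, pt_eq_iff.1 ?_⟩
      · rw [← h.lift_fst _ _ e, hw, pt_comp]
      · rw [← h.lift_snd _ _ e, hw, pt_comp]
    · exact pt_eq_iff.1 (h.hom_ext (pt_eq_iff.2 h₁) (pt_eq_iff.2 h₂))
  · rintro ⟨h₁, h₂, h₃⟩
    -- The lift is obtained from the representatives as generalised elements; joint injectivity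
    -- makes it respect the relations.
    have key : ∀ {E : Hex C} (φ : E ⟶ A) (ψ : E ⟶ B), φ ≫ homMk f hf = ψ ≫ homMk g hg →
        ∃ l : E ⟶ W, l ≫ homMk p hp = φ ∧ l ≫ homMk q hq = ψ := by
      intro E φ ψ e
      obtain ⟨u, hu, rfl⟩ := exists_homMk φ
      obtain ⟨v, hv, rfl⟩ := exists_homMk ψ
      obtain ⟨w, hwp, hwq⟩ := h₂ u v (homMk_comp_eq_comp_iff.1 e)
      refine ⟨homMk w fun T a b hab => h₃ _ _ ?_ ?_,
        homMk_comp_eq_iff.2 hwp, homMk_comp_eq_iff.2 hwq⟩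
      · simpa using ((hwp.precomp a).trans (hu _ _ hab)).trans (hwp.precomp b).symm
      · simpa using ((hwq.precomp a).trans (hv _ _ hab)).trans (hwq.precomp b).symm
    refine ⟨⟨homMk_comp_eq_comp_iff.2 h₁⟩, ⟨PullbackCone.IsLimit.mk _
      (fun s => (key s.fst s.snd s.condition).choose)
      (fun s => (key s.fst s.snd s.condition).choose_spec.1)
      (fun s => (key s.fst s.snd s.condition).choose_spec.2) (fun s m hm₁ hm₂ => ?_)⟩⟩
    obtain ⟨e₁, e₂⟩ := (key s.fst s.snd s.condition).choose_spec
    generalize (key s.fst s.snd s.condition).choose = n at e₁ e₂ ⊢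
    rw [← e₁] at hm₁
    rw [← e₂] at hm₂
    obtain ⟨m, hm, rfl⟩ := exists_homMk m
    obtain ⟨n, hn, rfl⟩ := exists_homMk n
    exact homMk_eq_iff.2 (h₃ _ _ (homMk_comp_eq_comp_iff.1 hm₁) (homMk_comp_eq_comp_iff.1 hm₂))

/-! ### Finite limits in `Hex C` -/

theorem exists_isPullback {A B D : Hex C} (φ : A ⟶ D) (ψ : B ⟶ D) :
    ∃ (W : Hex C) (p : W ⟶ A) (q : W ⟶ B), IsPullback p q φ ψ := by
  obtain ⟨f, hf, rfl⟩ := exists_homMk φ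
  obtain ⟨g, hg, rfl⟩ := exists_homMk ψ
  obtain ⟨X, π, -, hX⟩ := D.eqv_isFibRel.map f g
  simp only [Category.assoc] at hX
  -- `X` consists of pairs with a witness that their images are related; the relation ignores the
  -- witness, which makes lifts unique.
  let W : Hex C := of X (fun T w w' => A.Eqv (w ≫ π ≫ prod.fst) (w' ≫ π ≫ prod.fst) ∧
      B.Eqv (w ≫ π ≫ prod.snd) (w' ≫ π ≫ prod.snd))
    ((A.eqv_isFibRel.map _ _).and (B.eqv_isFibRel.map _ _))
    (fun T => ⟨fun w => ⟨.refl _, .refl _⟩, fun h => ⟨h.1.symm, h.2.symm⟩,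
      fun h h' => ⟨h.1.trans h'.1, h.2.trans h'.2⟩⟩)
  refine ⟨W, homMk (A := W) (π ≫ prod.fst) fun T u v h => ((of_eqv _ _).1 h).1,
    homMk (A := W) (π ≫ prod.snd) fun T u v h => ((of_eqv _ _).1 h).2,
    isPullback_iff.2 ⟨?_, fun T u v huv => ?_, fun T w w' h₁ h₂ => (of_eqv _ _).2 ⟨h₁, h₂⟩⟩⟩
  · simpa using (hX π).2 ⟨𝟙 X, by simp⟩
  · obtain ⟨H, hH⟩ := (hX (prod.lift u v)).1 (by simpa using huv)
    exact ⟨H, by simpa [reassoc_of% hH] using Eqv.refl u,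
      by simpa [reassoc_of% hH] using Eqv.refl v⟩

instance : HasPullbacks (Hex C) :=
  have (A B D : Hex C) (f : A ⟶ D) (g : B ⟶ D) : HasLimit (cospan f g) := by
    obtain ⟨W, p, q, h⟩ := exists_isPullback f g
    exact h.hasPullback
  hasPullbacks_of_hasLimit_cospan _

instance : HasTerminal (Hex C) := by
  let t : Hex C := of (⊤_ C) (fun _ _ _ => True) .top
    (fun _ => ⟨fun _ => trivial, fun _ => trivial, fun _ _ => trivial⟩)
  have ht : ∀ {A : Hex C} (φ ψ : A ⟶ t), φ = ψ := by
    intro A φ ψ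
    obtain ⟨f, hf, rfl⟩ := exists_homMk φ
    obtain ⟨g, hg, rfl⟩ := exists_homMk ψ
    exact homMk_eq_iff.2 ((of_eqv _ _).2 trivial)
  exact (IsTerminal.ofUniqueHom (Y := t)
    (fun A => homMk (B := t) (terminal.from A.X) fun _ _ _ _ => (of_eqv _ _).2 trivial)
    (fun _ _ => ht _ _)).hasTerminal

instance : HasFiniteLimits (Hex C) :=
  hasFiniteLimits_of_hasTerminal_and_pullbacks

/-! ### Quotients -/

section Quotient

variable {R A : Hex C} {p₁ p₂ : R.X ⟶ A.X} {hp₁ hp₂}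
  {E : ∀ ⦃T : C⦄, (T ⟶ A.X) → (T ⟶ A.X) → Prop} (hE : IsFibRel E)
  (hE' : ∀ T : C, Equivalence (@E T))

/-- The quotient map to the object with the same underlying object and a coarser relation. -/
noncomputable def quotientMap (hAE : ∀ ⦃T : C⦄ (u v : T ⟶ A.X), A.Eqv u v → E u v) :
    A ⟶ of A.X E hE hE' :=
  homMk (B := of A.X E hE hE') (𝟙 A.X) fun T u v h => by simpa [of_eqv] using hAE u v h

theorem quotientMap_condition (hAE : ∀ ⦃T : C⦄ (u v : T ⟶ A.X), A.Eqv u v → E u v)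
    (h : E p₁ p₂) :
    (homMk p₁ hp₁ : R ⟶ A) ≫ quotientMap hE hE' hAE = homMk p₂ hp₂ ≫ quotientMap hE hE' hAE :=
  homMk_comp_eq_comp_iff.2 (by simpa [of_eqv] using h)

theorem quotientMap_comp_eq_iff (hAE : ∀ ⦃T : C⦄ (u v : T ⟶ A.X), A.Eqv u v → E u v) {D : Hex C}
    {f g : A.X ⟶ D.X} {hf hg} :
    quotientMap hE hE' hAE ≫ homMk (A := of A.X E hE hE') g hg = (homMk f hf : A ⟶ D) ↔
      D.Eqv g f := by
  rw [quotientMap, homMk_comp_eq_iff, Category.id_comp]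

/-- The quotient map is represented by the identity, so a coequalising map descends with the same
representative; `h'` makes it respect the coarser relation. -/
theorem nonempty_isColimit_quotientMap
    (hAE : ∀ ⦃T : C⦄ (u v : T ⟶ A.X), A.Eqv u v → E u v) (h : E p₁ p₂)
    (h' : ∀ ⦃T : C⦄ (u v : T ⟶ A.X), E u v →
      ∃ w : T ⟶ R.X, A.Eqv (w ≫ p₁) u ∧ A.Eqv (w ≫ p₂) v) :
    Nonempty (IsColimit (Cofork.ofπ (quotientMap hE hE' hAE)
      (quotientMap_condition (hp₁ := hp₁) (hp₂ := hp₂) hE hE' hAE h))) := by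
  refine ⟨Cofork.IsColimit.ofExistsUnique fun s => ?_⟩
  obtain ⟨f, hf, hs⟩ := exists_homMk s.π
  have hs' := s.condition
  rw [hs] at hs' ⊢
  have e : s.pt.Eqv (p₁ ≫ f) (p₂ ≫ f) := homMk_comp_eq_comp_iff.1 hs'
  have hf' : ∀ ⦃T : C⦄ (u v : T ⟶ A.X), (of A.X E hE hE').Eqv u v →
      s.pt.Eqv (u ≫ f) (v ≫ f) := fun T u v huv => by
    obtain ⟨w, h₁, h₂⟩ := h' u v ((of_eqv _ _).1 huv)
    have h₁' := hf _ _ h₁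
    have h₂' := hf _ _ h₂
    simp only [Category.assoc] at h₁' h₂'
    exact h₁'.symm.trans ((e.precomp w).trans h₂')
  refine ⟨homMk (A := of A.X E hE hE') f hf', ?_, ?_⟩
  · exact (quotientMap_comp_eq_iff hE hE' hAE).2 (.refl _)
  · intro m hm
    obtain ⟨g, hg, rfl⟩ := exists_homMk m
    exact homMk_eq_iff.2 ((quotientMap_comp_eq_iff hE hE' hAE).1 hm)

theorem isKernelPair_quotientMap
    (hAE : ∀ ⦃T : C⦄ (u v : T ⟶ A.X), A.Eqv u v → E u v) (h : E p₁ p₂)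
    (h' : ∀ ⦃T : C⦄ (u v : T ⟶ A.X), E u v →
      ∃ w : T ⟶ R.X, A.Eqv (w ≫ p₁) u ∧ A.Eqv (w ≫ p₂) v)
    (h'' : ∀ ⦃T : C⦄ (w w' : T ⟶ R.X), A.Eqv (w ≫ p₁) (w' ≫ p₁) → A.Eqv (w ≫ p₂) (w' ≫ p₂) →
        R.Eqv w w') :
    IsKernelPair (quotientMap hE hE' hAE) (homMk p₁ hp₁ : R ⟶ A) (homMk p₂ hp₂) :=
  isPullback_iff.2 ⟨by simpa [of_eqv] using h,
    fun T u v huv => h' u v (by simpa [of_eqv] using huv), h''⟩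

end Quotient

/-! ### Regular epimorphisms and exactness -/

theorem isRegularEpi_of_section {A B : Hex C} {f : A.X ⟶ B.X} {hf} (s : B.X ⟶ A.X)
    (hs : B.Eqv (s ≫ f) (𝟙 B.X)) : IsRegularEpi (homMk f hf : A ⟶ B) := by
  obtain ⟨W, p, q, h⟩ := exists_isPullback (homMk f hf : A ⟶ B) (homMk f hf)
  obtain ⟨p, hp, rfl⟩ := exists_homMk p
  obtain ⟨q, hq, rfl⟩ := exists_homMk q
  have hsu : ∀ ⦃T : C⦄ (u : T ⟶ B.X), B.Eqv (u ≫ s ≫ f) u := fun T u => by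
    simpa using hs.precomp u
  refine ⟨⟨⟨W, _, _, h.w, Cofork.IsColimit.ofExistsUnique fun c => ?_⟩⟩⟩
  obtain ⟨g, hg, hc⟩ := exists_homMk c.π
  have hc' := c.condition
  rw [hc] at hc' ⊢
  have e : c.pt.Eqv (p ≫ g) (q ≫ g) := homMk_comp_eq_comp_iff.1 hc'
  -- The section `s` need not be a morphism of `Hex C`, but `s ≫ g` is: it sends related elements to
  -- related ones, as `g` coequalises the kernel pair of `f`.
  have key : ∀ ⦃T : C⦄ (u v : T ⟶ A.X), B.Eqv (u ≫ f) (v ≫ f) → c.pt.Eqv (u ≫ g) (v ≫ g) := by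
    intro T u v huv
    obtain ⟨w, h₁, h₂⟩ := (isPullback_iff.1 h).2.1 u v huv
    have h₁' := hg _ _ h₁
    have h₂' := hg _ _ h₂
    simp only [Category.assoc] at h₁' h₂'
    exact h₁'.symm.trans ((e.precomp w).trans h₂')
  have hsg : ∀ ⦃T : C⦄ (u v : T ⟶ B.X), B.Eqv u v → c.pt.Eqv (u ≫ s ≫ g) (v ≫ s ≫ g) := by
    intro T u v huv
    have := key (u ≫ s) (v ≫ s)
    simp only [Category.assoc] at this
    exact this ((hsu u).trans (huv.trans (hsu v).symm))
  refine ⟨homMk (s ≫ g) hsg, ?_, ?_⟩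
  · have := key (f ≫ s) (𝟙 _) (by simpa using hsu f)
    exact (homMk_comp_eq_iff (hf := hf) (hg := hsg)).2 (by simpa using this)
  · intro m hm
    obtain ⟨m, hm', rfl⟩ := exists_homMk m
    have h₁ : c.pt.Eqv (s ≫ f ≫ m) (s ≫ g) := ((homMk_comp_eq_iff (hf := hf)).1 hm).precomp s
    have h₂ := hm' _ _ hs
    simp only [Category.assoc, Category.id_comp] at h₂
    exact homMk_eq_iff.2 (h₂.symm.trans h₁)

theorem exists_section_of_isRegularEpi {A B : Hex C} {f : A.X ⟶ B.X} {hf}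
    (h : IsRegularEpi (homMk f hf : A ⟶ B)) : ∃ s : B.X ⟶ A.X, B.Eqv (s ≫ f) (𝟙 B.X) := by
  have hE : IsFibRel fun (T : C) (u v : T ⟶ A.X) => B.Eqv (u ≫ f) (v ≫ f) :=
    B.eqv_isFibRel.map f f
  have hE' : ∀ T : C, Equivalence fun (u v : T ⟶ A.X) => B.Eqv (u ≫ f) (v ≫ f) :=
    fun T => ⟨fun _ => .refl _, .symm, .trans⟩
  let π := quotientMap hE hE' hf
  -- Coarsening the relation on `A` to the kernel of `f` factors `f` as `π` followed by a mono `m`.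
  -- As `f` is a strong epi, `m` is invertible, and a representative of its inverse is the section.
  let m : of A.X _ hE hE' ⟶ B :=
    homMk (A := of A.X _ hE hE') f fun T u v huv => (of_eqv hE hE').1 huv
  have hm : Mono m := ⟨fun {Z} φ ψ e => by
    obtain ⟨a, ha, rfl⟩ := exists_homMk φ
    obtain ⟨b, hb, rfl⟩ := exists_homMk ψ
    exact homMk_eq_iff.2 ((of_eqv _ _).2 (homMk_comp_eq_comp_iff.1 e))⟩
  have fac : π ≫ m = homMk f hf := homMk_comp_eq_iff.2 (by simpa using Eqv.refl _)
  have : StrongEpi (homMk f hf : A ⟶ B) := inferInstance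
  have : StrongEpi m := by
    rw [← fac] at this
    exact strongEpi_of_strongEpi π m
  have : IsIso m := isIso_of_mono_of_strongEpi m
  obtain ⟨s, hs, e⟩ := exists_homMk (inv m)
  have e' := IsIso.inv_hom_id m
  rw [e] at e'
  exact ⟨s, homMk_comp_eq_id_iff.1 e'⟩

theorem regular : Regular (Hex C) where
  hasCoequalizer_of_isKernelPair := by
    intro A B R φ ψ₁ ψ₂ h
    obtain ⟨f, hf, rfl⟩ := exists_homMk φ
    obtain ⟨p₁, hp₁, rfl⟩ := exists_homMk ψ₁
    obtain ⟨p₂, hp₂, rfl⟩ := exists_homMk ψ₂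
    obtain ⟨h₁, h₂, -⟩ := isPullback_iff.1 h
    obtain ⟨hc⟩ := nonempty_isColimit_quotientMap (hp₁ := hp₁) (hp₂ := hp₂)
      (B.eqv_isFibRel.map f f) (fun T => ⟨fun _ => .refl _, .symm, .trans⟩) hf h₁ h₂
    exact ⟨⟨_, hc⟩⟩
  regularEpiIsStableUnderBaseChange := by
    refine ⟨fun {A B A' B' ψ φ p q} h hφ => ?_⟩
    obtain ⟨f, hf, rfl⟩ := exists_homMk φ
    obtain ⟨g, hg, rfl⟩ := exists_homMk ψ
    obtain ⟨p, hp, rfl⟩ := exists_homMk p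
    obtain ⟨q, hq, rfl⟩ := exists_homMk q
    obtain ⟨s, hs⟩ := exists_section_of_isRegularEpi hφ
    -- The pair `(g ≫ s, 𝟙)` is an element of the pullback, so the section pulls back.
    obtain ⟨t, -, ht⟩ := (isPullback_iff.1 h).2.1 (g ≫ s) (𝟙 _)
      (by simpa using hs.precomp g)
    exact isRegularEpi_of_section t ht

theorem effective {R A : Hex C} (φ₁ φ₂ : R ⟶ A) (h : IsEquivalenceRelation φ₁ φ₂) :
    IsEffectiveEquivalenceRelation φ₁ φ₂ := by
  obtain ⟨p₁, hp₁, rfl⟩ := exists_homMk φ₁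
  obtain ⟨p₂, hp₂, rfl⟩ := exists_homMk φ₂
  obtain ⟨⟨e⟩⟩ := h
  have mono : ∀ ⦃T : C⦄ (w w' : T ⟶ R.X), A.Eqv (w ≫ p₁) (w' ≫ p₁) →
      A.Eqv (w ≫ p₂) (w' ≫ p₂) → R.Eqv w w' := fun T w w' h₁ h₂ =>
    pt_eq_iff.1 (e.right_cancellation _ _ (pt_eq_iff.2 h₁) (pt_eq_iff.2 h₂))
  let E : ∀ ⦃T : C⦄, (T ⟶ A.X) → (T ⟶ A.X) → Prop := fun T u v =>
    ∃ w : T ⟶ R.X, A.Eqv (w ≫ p₁) u ∧ A.Eqv (w ≫ p₂) v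
  have hE : IsFibRel E := by
    have h₁ := A.eqv_isFibRel.map p₁ (𝟙 _)
    have h₂ := A.eqv_isFibRel.map p₂ (𝟙 _)
    simp only [Category.comp_id] at h₁ h₂
    exact h₁.exists_middle h₂
  have E_iff : ∀ ⦃T : C⦄ (u v : T ⟶ A.X), E u v ↔
      ∃ w : y T ⟶ R, w ≫ homMk p₁ hp₁ = pt u ∧ w ≫ homMk p₂ hp₂ = pt v := by
    intro T u v
    constructor
    · rintro ⟨w, h₁, h₂⟩
      exact ⟨pt w, pt_eq_iff.2 h₁, pt_eq_iff.2 h₂⟩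
    · rintro ⟨w, h₁, h₂⟩
      obtain ⟨w, rfl⟩ := exists_pt w
      exact ⟨w, pt_eq_iff.1 h₁, pt_eq_iff.1 h₂⟩
  have hE' : ∀ T : C, Equivalence (@E T) := fun T => by
    refine ⟨fun u => (E_iff _ _).2 ⟨pt u ≫ e.r, by simp, by simp⟩, fun {u v} huv => ?_,
      fun {u v x} huv hvx => ?_⟩
    · obtain ⟨w, h₁, h₂⟩ := (E_iff _ _).1 huv
      exact (E_iff _ _).2 ⟨w ≫ e.s, by rw [Category.assoc, e.symmetry₁, h₂],
        by rw [Category.assoc, e.symmetry₂, h₁]⟩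
    · obtain ⟨w, h₁, h₂⟩ := (E_iff _ _).1 huv
      obtain ⟨w', h₁', h₂'⟩ := (E_iff _ _).1 hvx
      refine (E_iff _ _).2 ⟨PullbackCone.IsLimit.lift e.isLimit w w' (h₂.trans h₁'.symm) ≫ e.t,
        ?_, ?_⟩
      · rw [Category.assoc, e.transitivity₁, PullbackCone.IsLimit.lift_fst_assoc, h₁]
      · rw [Category.assoc, e.transitivity₂, PullbackCone.IsLimit.lift_snd_assoc, h₂']
  have hp : E p₁ p₂ := ⟨𝟙 _, by simpa using Eqv.refl _, by simpa using Eqv.refl _⟩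
  have hAE : ∀ ⦃T : C⦄ (u v : T ⟶ A.X), A.Eqv u v → E u v := by
    intro T u v huv
    obtain ⟨w, h₁, h₂⟩ := (hE' T).refl u
    exact ⟨w, h₁, h₂.trans huv⟩
  obtain ⟨hc⟩ := nonempty_isColimit_quotientMap (hp₁ := hp₁) (hp₂ := hp₂) hE hE' hAE hp
    (fun _ _ _ h => h)
  -- Reflexivity is a common section of the two projections, so the legs of any pushout cocone
  -- coincide and the coequaliser is also the pushout.
  have inl_eq : ∀ {Z : Hex C} (a b : A ⟶ Z), homMk p₁ hp₁ ≫ a = homMk p₂ hp₂ ≫ b → a = b := by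
    intro Z a b hab
    have := congrArg (e.r ≫ ·) hab
    simpa only [← Category.assoc, e.reflexivity₁, e.reflexivity₂, Category.id_comp] using this
  have hs : ∀ s : PushoutCocone (homMk p₁ hp₁ : R ⟶ A) (homMk p₂ hp₂),
      homMk p₁ hp₁ ≫ s.inl = homMk p₂ hp₂ ≫ s.inl := fun s => by
    conv_rhs => rw [inl_eq _ _ s.condition]
    exact s.condition
  have hfac : ∀ s, quotientMap hE hE' hAE ≫ hc.desc (Cofork.ofπ s.inl (hs s)) = s.inl :=
    fun s => hc.fac _ WalkingParallelPair.one
  exact ⟨⟨{ e with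
    B := _
    π := quotientMap hE hE' hAE
    isKernelPair := isKernelPair_quotientMap hE hE' hAE hp (fun _ _ _ h => h) mono
    isPushout := ⟨⟨quotientMap_condition hE hE' hAE hp⟩, ⟨PushoutCocone.IsColimit.mk _
      (fun s => hc.desc (Cofork.ofπ s.inl (hs s))) hfac
      (fun s => (hfac s).trans (inl_eq _ _ s.condition))
      (fun s m hm _ => Cofork.IsColimit.hom_ext hc (hm.trans (hfac s).symm))⟩⟩ }⟩⟩

end Hex

namespace Hex

/-! ### Coproducts -/

/-- A description of coproducts in `Hex C` in terms of generalised elements: the injections are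
monomorphisms with homotopy initial intersection, and every generalised element of the coproduct
splits over a homotopy sum. -/
structure IsPointwiseCoproduct {A B S : Hex C} (i : A.X ⟶ S.X) (j : B.X ⟶ S.X) : Prop where
  mono_left : ∀ ⦃T : C⦄ ⦃u v : T ⟶ A.X⦄, S.Eqv (u ≫ i) (v ≫ i) → A.Eqv u v
  mono_right : ∀ ⦃T : C⦄ ⦃u v : T ⟶ B.X⦄, S.Eqv (u ≫ j) (v ≫ j) → B.Eqv u v
  disjoint : ∀ ⦃T : C⦄ ⦃u : T ⟶ A.X⦄ ⦃v : T ⟶ B.X⦄, S.Eqv (u ≫ i) (v ≫ j) → IsHomotopyInitial T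
  cover : ∀ ⦃T : C⦄ (x : T ⟶ S.X), ∃ (D E : C) (k : D ⟶ T) (l : E ⟶ T) (a : D ⟶ A.X)
    (b : E ⟶ B.X), IsHomotopySum k l ∧ S.Eqv (k ≫ x) (a ≫ i) ∧ S.Eqv (l ≫ x) (b ≫ j)

namespace IsPointwiseCoproduct

variable {A B S : Hex C} {i : A.X ⟶ S.X} {j : B.X ⟶ S.X}

theorem symm (h : IsPointwiseCoproduct i j) : IsPointwiseCoproduct j i where
  mono_left := h.mono_right
  mono_right := h.mono_left
  disjoint _ _ _ e := h.disjoint e.symm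
  cover _ x := by
    obtain ⟨D, E, k, l, a, b, hkl, hk, hl⟩ := h.cover x
    exact ⟨E, D, l, k, b, a, hkl.symm, hl, hk⟩

/-- Split `u` over `k` and `l`. On the first part monicity of `i` identifies the element of `A`; the
second part is initial by disjointness. -/
theorem comp_desc (hC : IsHomotopyExtensive C) (h : IsPointwiseCoproduct i j) {V : Hex C}
    {D E : C} {k : D ⟶ S.X} {l : E ⟶ S.X} (hkl : IsHomotopySum k l) {a : D ⟶ A.X}
    {b : E ⟶ B.X} (ha : S.Eqv k (a ≫ i)) (hb : S.Eqv l (b ≫ j)) {f : A.X ⟶ V.X}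
    (hf : ∀ ⦃T : C⦄ (u v : T ⟶ A.X), A.Eqv u v → V.Eqv (u ≫ f) (v ≫ f)) {d : S.X ⟶ V.X}
    (hd : V.Eqv (k ≫ d) (a ≫ f)) ⦃T : C⦄ (u : T ⟶ S.X) (c : T ⟶ A.X)
    (huc : S.Eqv u (c ≫ i)) : V.Eqv (u ≫ d) (c ≫ f) := by
  obtain ⟨T₁, T₂, k', l', x, y, hkl', hx, hy⟩ := hkl.exists_split hC u
  refine .of_sum hkl' ?_ ?_
  · have h₁ : A.Eqv (x ≫ a) (k' ≫ c) := h.mono_left <| by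
      simpa using ((ha.precomp x).symm.trans hx.symm.eqv).trans (huc.precomp k')
    have h₂ : V.Eqv (k' ≫ u ≫ d) (x ≫ k ≫ d) := by simpa using (hx.postcomp d).eqv
    simpa using h₂.trans ((hd.precomp x).trans (by simpa using hf _ _ h₁))
  · refine .of_initial (h.disjoint (u := l' ≫ c) (v := y ≫ b) ?_) _ _
    simpa using (huc.precomp l').symm.trans (hy.eqv.trans (hb.precomp y))

theorem exists_desc (hC : IsHomotopyExtensive C) (h : IsPointwiseCoproduct i j) {V : Hex C}
    {f : A.X ⟶ V.X} {g : B.X ⟶ V.X}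
    (hf : ∀ ⦃T : C⦄ (u v : T ⟶ A.X), A.Eqv u v → V.Eqv (u ≫ f) (v ≫ f))
    (hg : ∀ ⦃T : C⦄ (u v : T ⟶ B.X), B.Eqv u v → V.Eqv (u ≫ g) (v ≫ g)) :
    ∃ d : S.X ⟶ V.X, (∀ ⦃T : C⦄ (u v : T ⟶ S.X), S.Eqv u v → V.Eqv (u ≫ d) (v ≫ d)) ∧
      V.Eqv (i ≫ d) f ∧ V.Eqv (j ≫ d) g := by
  -- Splitting the generic element writes `S.X` itself as a homotopy sum of parts lying in `A` and
  -- in `B`, and `d` is glued from them.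
  obtain ⟨D, E, k, l, a, b, hkl, hk, hl⟩ := h.cover (𝟙 S.X)
  simp only [Category.comp_id] at hk hl
  obtain ⟨d, ⟨hd₁, hd₂⟩, -⟩ := hkl _ (a ≫ f) (b ≫ g)
  have h₁ := h.comp_desc hC hkl hk hl hf hd₁.eqv
  have h₂ := h.symm.comp_desc hC hkl.symm hl hk hg hd₂.eqv
  refine ⟨d, fun T u v huv => ?_, by simpa using h₁ i (𝟙 _) (by simpa using Eqv.refl i),
    by simpa using h₂ j (𝟙 _) (by simpa using Eqv.refl j)⟩
  obtain ⟨T₁, T₂, k', l', x, y, hkl', hx, hy⟩ := h.cover u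
  refine .of_sum hkl' ?_ ?_
  · simpa using (h₁ _ _ hx).trans (h₁ _ _ ((huv.precomp k').symm.trans hx)).symm
  · simpa using (h₂ _ _ hy).trans (h₂ _ _ ((huv.precomp l').symm.trans hy)).symm

theorem eqv_of_comp (h : IsPointwiseCoproduct i j) {V : Hex C} {d d' : S.X ⟶ V.X}
    (hd : ∀ ⦃T : C⦄ (u v : T ⟶ S.X), S.Eqv u v → V.Eqv (u ≫ d) (v ≫ d))
    (hd' : ∀ ⦃T : C⦄ (u v : T ⟶ S.X), S.Eqv u v → V.Eqv (u ≫ d') (v ≫ d'))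
    (h₁ : V.Eqv (i ≫ d) (i ≫ d')) (h₂ : V.Eqv (j ≫ d) (j ≫ d')) : V.Eqv d d' := by
  obtain ⟨D, E, k, l, a, b, hkl, hk, hl⟩ := h.cover (𝟙 S.X)
  simp only [Category.comp_id] at hk hl
  refine .of_sum hkl ?_ ?_
  · have e := (h₁.precomp a)
    simp only [← Category.assoc] at e
    exact (hd _ _ hk).trans (e.trans (hd' _ _ hk).symm)
  · have e := (h₂.precomp b)
    simp only [← Category.assoc] at e
    exact (hd _ _ hl).trans (e.trans (hd' _ _ hl).symm)

theorem nonempty_isColimit (hC : IsHomotopyExtensive C) (h : IsPointwiseCoproduct i j) {hi hj} :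
    Nonempty (IsColimit (BinaryCofan.mk (homMk i hi : A ⟶ S) (homMk j hj : B ⟶ S))) := by
  have key : ∀ {V : Hex C} (φ : A ⟶ V) (ψ : B ⟶ V),
      ∃ δ : S ⟶ V, homMk i hi ≫ δ = φ ∧ homMk j hj ≫ δ = ψ := by
    intro V φ ψ
    obtain ⟨f, hf, rfl⟩ := exists_homMk φ
    obtain ⟨g, hg, rfl⟩ := exists_homMk ψ
    obtain ⟨d, hd, h₁, h₂⟩ := h.exists_desc hC hf hg
    exact ⟨homMk d hd, homMk_comp_eq_iff.2 h₁, homMk_comp_eq_iff.2 h₂⟩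
  have ext : ∀ {V : Hex C} (δ δ' : S ⟶ V), homMk i hi ≫ δ = homMk i hi ≫ δ' →
      homMk j hj ≫ δ = homMk j hj ≫ δ' → δ = δ' := by
    intro V δ δ' h₁ h₂
    obtain ⟨d, hd, rfl⟩ := exists_homMk δ
    obtain ⟨d', hd', rfl⟩ := exists_homMk δ'
    exact homMk_eq_iff.2 (h.eqv_of_comp hd hd' (homMk_comp_eq_comp_iff.1 h₁)
      (homMk_comp_eq_comp_iff.1 h₂))
  choose δ hδ₁ hδ₂ using @key
  exact ⟨BinaryCofan.isColimitMk (fun s => δ s.inl s.inr) (fun s => hδ₁ _ _) (fun s => hδ₂ _ _)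
    (fun s m h₁ h₂ => ext _ _ (h₁.trans (hδ₁ _ _).symm) (h₂.trans (hδ₂ _ _).symm))⟩

theorem of_iso (h : IsPointwiseCoproduct i j) {S' : Hex C} {i' : A.X ⟶ S'.X} {j' : B.X ⟶ S'.X}
    {hi hj hi' hj'} (e : S ≅ S') (h₁ : homMk i hi ≫ e.hom = homMk i' hi')
    (h₂ : homMk j hj ≫ e.hom = homMk j' hj') : IsPointwiseCoproduct i' j' := by
  obtain ⟨f, hf, hef⟩ := exists_homMk e.hom
  obtain ⟨g, hg, heg⟩ := exists_homMk e.inv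
  have h₃ := e.inv_hom_id
  have h₄ : homMk i hi = homMk i' hi' ≫ e.inv := by rw [← h₁]; simp
  have h₅ : homMk j hj = homMk j' hj' ≫ e.inv := by rw [← h₂]; simp
  rw [hef] at h₁ h₂ h₃
  rw [heg] at h₃ h₄ h₅
  replace h₁ := homMk_comp_eq_iff.1 h₁
  replace h₂ := homMk_comp_eq_iff.1 h₂
  replace h₃ := homMk_comp_eq_id_iff.1 h₃
  replace h₄ := homMk_comp_eq_iff.1 h₄.symm
  replace h₅ := homMk_comp_eq_iff.1 h₅.symm
  have left : ∀ ⦃T : C⦄ (u : T ⟶ A.X), S.Eqv ((u ≫ i') ≫ g) (u ≫ i) := fun T u => by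
    simpa using h₄.precomp u
  have right : ∀ ⦃T : C⦄ (u : T ⟶ B.X), S.Eqv ((u ≫ j') ≫ g) (u ≫ j) := fun T u => by
    simpa using h₅.precomp u
  refine ⟨fun T u v huv => h.mono_left ?_, fun T u v huv => h.mono_right ?_,
    fun T u v huv => h.disjoint (u := u) (v := v) ?_, fun T x => ?_⟩
  · exact (left u).symm.trans ((hg _ _ huv).trans (left v))
  · exact (right u).symm.trans ((hg _ _ huv).trans (right v))
  · exact (left u).symm.trans ((hg _ _ huv).trans (right v))
  · obtain ⟨D, E, k, l, a, b, hkl, hk, hl⟩ := h.cover (x ≫ g)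
    have hx : S'.Eqv (x ≫ g ≫ f) x := by simpa using h₃.precomp x
    have hk' := hf _ _ hk
    have hl' := hf _ _ hl
    simp only [Category.assoc] at hk' hl'
    exact ⟨D, E, k, l, a, b, hkl, (hx.precomp k).symm.trans (hk'.trans (h₁.precomp a)),
      (hx.precomp l).symm.trans (hl'.trans (h₂.precomp b))⟩

end IsPointwiseCoproduct

theorem exists_isPointwiseCoproduct (hC : IsHomotopyExtensive C) (A B : Hex C) :
    ∃ (S : Hex C) (i : A.X ⟶ S.X) (j : B.X ⟶ S.X),
      (∀ ⦃T : C⦄ (u v : T ⟶ A.X), A.Eqv u v → S.Eqv (u ≫ i) (v ≫ i)) ∧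
      (∀ ⦃T : C⦄ (u v : T ⟶ B.X), B.Eqv u v → S.Eqv (u ≫ j) (v ≫ j)) ∧
      IsPointwiseCoproduct i j := by
  obtain ⟨S, i, j, hS, -, -⟩ := hC.exists_sum A.X B.X
  obtain ⟨N, iN, jN, hN, -, -⟩ := hC.exists_sum A.R B.R
  obtain ⟨m₁, ⟨hi₁, hj₁⟩, -⟩ := hN S ((A.ρ ≫ prod.fst) ≫ i) ((B.ρ ≫ prod.fst) ≫ j)
  obtain ⟨m₂, ⟨hi₂, hj₂⟩, -⟩ := hN S ((A.ρ ≫ prod.snd) ≫ i) ((B.ρ ≫ prod.snd) ≫ j)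
  -- The relation is the sum of `A.R` and `B.R`. Since `N ⟶ S ⨯ S` need not be a fibration,
  -- endpoints are matched only up to homotopy.
  let E : ∀ ⦃T : C⦄, (T ⟶ S) → (T ⟶ S) → Prop := fun T x x' =>
    ∃ w : T ⟶ N, Homotopic (w ≫ m₁) x ∧ Homotopic (w ≫ m₂) x'
  have hE : IsFibRel E := by
    have h₁ := (homotopic_isFibRel S).map m₁ (𝟙 _)
    have h₂ := (homotopic_isFibRel S).map m₂ (𝟙 _)
    simp only [Category.comp_id] at h₁ h₂
    exact h₁.exists_middle h₂
  have E_left : ∀ ⦃T : C⦄ (u v : T ⟶ A.X), A.Eqv u v → E (u ≫ i) (v ≫ i) := by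
    rintro T u v ⟨H, hH⟩
    refine ⟨H ≫ iN, ?_, ?_⟩
    · simpa [reassoc_of% hH] using hi₁.precomp H
    · simpa [reassoc_of% hH] using hi₂.precomp H
  have E_right : ∀ ⦃T : C⦄ (u v : T ⟶ B.X), B.Eqv u v → E (u ≫ j) (v ≫ j) := by
    rintro T u v ⟨H, hH⟩
    refine ⟨H ≫ jN, ?_, ?_⟩
    · simpa [reassoc_of% hH] using hj₁.precomp H
    · simpa [reassoc_of% hH] using hj₂.precomp H
  have E_split : ∀ ⦃T : C⦄ (x x' : T ⟶ S), E x x' → ∃ (T₁ T₂ : C) (k : T₁ ⟶ T) (l : T₂ ⟶ T)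
      (u u' : T₁ ⟶ A.X) (v v' : T₂ ⟶ B.X), IsHomotopySum k l ∧ A.Eqv u u' ∧ B.Eqv v v' ∧
      Homotopic (k ≫ x) (u ≫ i) ∧ Homotopic (k ≫ x') (u' ≫ i) ∧
      Homotopic (l ≫ x) (v ≫ j) ∧ Homotopic (l ≫ x') (v' ≫ j) := by
    rintro T x x' ⟨w, hx, hx'⟩
    obtain ⟨T₁, T₂, k, l, α, β, hkl, hk, hl⟩ := hN.exists_split hC w
    refine ⟨T₁, T₂, k, l, α ≫ A.ρ ≫ prod.fst, α ≫ A.ρ ≫ prod.snd, β ≫ B.ρ ≫ prod.fst,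
      β ≫ B.ρ ≫ prod.snd, hkl, ⟨α, by ext <;> simp⟩, ⟨β, by ext <;> simp⟩, ?_, ?_, ?_, ?_⟩
    · have := (hk.postcomp m₁).trans (by simpa using hi₁.precomp α)
      exact (hx.precomp k).symm.trans (by simpa using this)
    · have := (hk.postcomp m₂).trans (by simpa using hi₂.precomp α)
      exact (hx'.precomp k).symm.trans (by simpa using this)
    · have := (hl.postcomp m₁).trans (by simpa using hj₁.precomp β)
      exact (hx.precomp l).symm.trans (by simpa using this)
    · have := (hl.postcomp m₂).trans (by simpa using hj₂.precomp β)
      exact (hx'.precomp l).symm.trans (by simpa using this)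
  have hom : ∀ ⦃T : C⦄ {x x' z z' : T ⟶ S}, E z z' → Homotopic x z → Homotopic x' z' → E x x' :=
    fun T x x' z z' h h₁ h₂ => hE.homotopic_trans h₁ (hE.trans_homotopic h h₂.symm)
  have refl : ∀ ⦃T : C⦄ (x : T ⟶ S), E x x := fun T x => by
    obtain ⟨D, D', k, l, a, b, hkl, hk, hl⟩ := hS.exists_split hC x
    exact hE.of_sum hkl (hom (E_left _ _ (.refl a)) hk hk) (hom (E_right _ _ (.refl b)) hl hl)
  have symm : ∀ ⦃T : C⦄ {x x' : T ⟶ S}, E x x' → E x' x := fun T x x' h => by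
    obtain ⟨T₁, T₂, k, l, u, u', v, v', hkl, hu, hv, h₁, h₂, h₃, h₄⟩ := E_split _ _ h
    exact hE.of_sum hkl (hom (E_left _ _ hu.symm) h₂ h₁) (hom (E_right _ _ hv.symm) h₄ h₃)
  have disj : ∀ ⦃T : C⦄ {u : T ⟶ A.X} {v : T ⟶ B.X}, E (u ≫ i) (v ≫ j) →
      IsHomotopyInitial T := fun T u v h => by
    obtain ⟨T₁, T₂, k, l, a, a', b, b', hkl, -, -, -, h₂, h₃, -⟩ := E_split _ _ h
    refine .of_sum hkl (hS.disjoint hC (u := a') (v := k ≫ v) ?_)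
      (hS.disjoint hC (u := l ≫ u) (v := b) ?_)
    · simpa using h₂.symm
    · simpa using h₃
  have mono_left : ∀ ⦃T : C⦄ ⦃u v : T ⟶ A.X⦄, E (u ≫ i) (v ≫ i) → A.Eqv u v := fun T u v h => by
    obtain ⟨T₁, T₂, k, l, a, a', b, b', hkl, ha, -, h₁, h₂, h₃, -⟩ := E_split _ _ h
    rw [← Category.assoc] at h₁ h₂ h₃
    exact .of_sum hkl ((hS.mono hC h₁).eqv.trans (ha.trans (hS.mono hC h₂).symm.eqv))
      (.of_initial (hS.disjoint hC h₃) _ _)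
  have mono_right : ∀ ⦃T : C⦄ ⦃u v : T ⟶ B.X⦄, E (u ≫ j) (v ≫ j) → B.Eqv u v :=
    fun T u v h => by
    obtain ⟨T₁, T₂, k, l, a, a', b, b', hkl, -, hb, h₁, -, h₃, h₄⟩ := E_split _ _ h
    rw [← Category.assoc] at h₁ h₃ h₄
    exact .of_sum hkl (.of_initial (hS.disjoint hC h₁.symm) _ _)
      ((hS.symm.mono hC h₃).eqv.trans (hb.trans (hS.symm.mono hC h₄).symm.eqv))
  -- Splitting for `x, y` and then again for `y, z` gives four parts. The mixed ones are initial, as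
  -- `y` would lie in both summands.
  have trans : ∀ ⦃T : C⦄ {x y z : T ⟶ S}, E x y → E y z → E x z := fun T x y z hxy hyz => by
    obtain ⟨T₁, T₂, k, l, a, a', b, b', hkl, ha, hb, h₁, h₂, h₃, h₄⟩ := E_split _ _ hxy
    refine hE.of_sum hkl ?_ ?_
    · have hyz' := hom (hE.precomp k hyz) h₂.symm (.refl _)
      obtain ⟨T₁', T₂', k', l', c, c', d, d', hkl', hc, hd, e₁, e₂, e₃, e₄⟩ := E_split _ _ hyz'
      rw [← Category.assoc] at e₁ e₃
      refine hE.of_sum hkl' (hom (E_left (k' ≫ a) c' ?_) (by simpa using h₁.precomp k') e₂)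
        (hE.of_initial (hS.disjoint hC e₃) _ _)
      exact (ha.precomp k').trans ((hS.mono hC e₁).eqv.trans hc)
    · have hyz' := hom (hE.precomp l hyz) h₄.symm (.refl _)
      obtain ⟨T₁', T₂', k', l', c, c', d, d', hkl', hc, hd, e₁, e₂, e₃, e₄⟩ := E_split _ _ hyz'
      rw [← Category.assoc] at e₁ e₃
      refine hE.of_sum hkl' (hE.of_initial (hS.disjoint hC e₁.symm) _ _)
        (hom (E_right (l' ≫ b) d' ?_) (by simpa using h₃.precomp l') e₄)
      exact (hb.precomp l').trans ((hS.symm.mono hC e₃).eqv.trans hd)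
  have hE' : ∀ T : C, Equivalence (@E T) := fun T => ⟨@refl T, @symm T, @trans T⟩
  refine ⟨of S E hE hE', i, j, fun T u v h => (of_eqv hE hE').2 (E_left _ _ h),
    fun T u v h => (of_eqv hE hE').2 (E_right _ _ h),
    fun T u v h => mono_left ((of_eqv hE hE').1 h), fun T u v h => mono_right ((of_eqv hE hE').1 h),
    fun T u v h => disj ((of_eqv hE hE').1 h), fun T x => ?_⟩
  obtain ⟨D, D', k, l, a, b, hkl, hk, hl⟩ := hS.exists_split hC x
  exact ⟨D, D', k, l, a, b, hkl, hk.eqv (A := of S E hE hE'), hl.eqv (A := of S E hE hE')⟩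

/-- Any coproduct is isomorphic to the constructed one, and the elementwise description is invariant
under isomorphism. -/
theorem nonempty_isColimit_iff (hC : IsHomotopyExtensive C) {A B : Hex C} {c : BinaryCofan A B}
    {i : A.X ⟶ c.pt.X} {j : B.X ⟶ c.pt.X} {hi hj} (hci : c.inl = homMk i hi)
    (hcj : c.inr = homMk j hj) : Nonempty (IsColimit c) ↔ IsPointwiseCoproduct i j := by
  constructor
  · rintro ⟨hc⟩
    obtain ⟨S, i₀, j₀, hi₀, hj₀, h⟩ := exists_isPointwiseCoproduct hC A B
    obtain ⟨h'⟩ := h.nonempty_isColimit hC (hi := hi₀) (hj := hj₀)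
    refine h.of_iso (hi := hi₀) (hj := hj₀) (hi' := hi) (hj' := hj)
      (h'.coconePointUniqueUpToIso hc) ?_ ?_
    · rw [← hci]
      exact h'.comp_coconePointUniqueUpToIso_hom hc ⟨WalkingPair.left⟩
    · rw [← hcj]
      exact h'.comp_coconePointUniqueUpToIso_hom hc ⟨WalkingPair.right⟩
  · intro h
    obtain ⟨h'⟩ := h.nonempty_isColimit hC (hi := hi) (hj := hj)
    refine ⟨IsColimit.ofIsoColimit h' (BinaryCofan.ext (Iso.refl _) ?_ ?_)⟩
    · exact (Category.comp_id _).trans hci.symm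
    · exact (Category.comp_id _).trans hcj.symm

/-! ### The van Kampen property -/

theorem isPullback_of_isPointwiseCoproduct {A B S A' B' S' : Hex C}
    {i : A.X ⟶ S.X} {j : B.X ⟶ S.X} {i' : A'.X ⟶ S'.X} {j' : B'.X ⟶ S'.X} {α : A'.X ⟶ A.X}
    {β : B'.X ⟶ B.X} {f : S'.X ⟶ S.X} {hi hi' hα hf} (h : IsPointwiseCoproduct i j)
    (h' : IsPointwiseCoproduct i' j')
    (h₁ : S.Eqv (α ≫ i) (i' ≫ f)) (h₂ : S.Eqv (β ≫ j) (j' ≫ f)) :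
    IsPullback (homMk i' hi' : A' ⟶ S') (homMk α hα : A' ⟶ A) (homMk f hf : S' ⟶ S)
      (homMk i hi : A ⟶ S) := by
  refine isPullback_iff.2 ⟨h₁.symm, fun T x u hxu => ?_, fun T w w' hw _ => h'.mono_left hw⟩
  obtain ⟨D, E, k, l, a, b, hkl, hk, hl⟩ := h'.cover x
  -- The part of `x` in `B'` would map into both `A` and `B`, so it is empty, and the part in `A'`
  -- extends to all of `T`.
  have hE : IsHomotopyInitial E := h.disjoint (u := l ≫ u) (v := b ≫ β) <| by
    have e₁ := hf _ _ hl
    simp only [Category.assoc] at e₁ ⊢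
    exact (hxu.precomp l).symm.trans (e₁.trans (h₂.precomp b).symm)
  obtain ⟨w, ⟨hw, -⟩, -⟩ := hkl A'.X a (hE A'.X).choose
  have hwx : S'.Eqv (w ≫ i') x := .of_sum hkl
    (by simpa using (hi' _ _ hw.eqv).trans hk.symm) (.of_initial hE _ _)
  refine ⟨w, hwx, h.mono_left ?_⟩
  have e₂ := hf _ _ hwx
  simp only [Category.assoc] at e₂ ⊢
  exact (h₁.precomp w).trans (e₂.trans hxu)

/-- Each clause is inherited from `S` along `f`; in particular a splitting of `x ≫ f` lifts through
the two pullbacks to a splitting of `x`. -/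
theorem isPointwiseCoproduct_of_isPullback {A B S A' B' S' : Hex C}
    {i : A.X ⟶ S.X} {j : B.X ⟶ S.X} {i' : A'.X ⟶ S'.X} {j' : B'.X ⟶ S'.X} {α : A'.X ⟶ A.X}
    {β : B'.X ⟶ B.X} {f : S'.X ⟶ S.X} {hi hi' hα hf hj hj' hβ} (h : IsPointwiseCoproduct i j)
    (h₁ : IsPullback (homMk i' hi' : A' ⟶ S') (homMk α hα : A' ⟶ A) (homMk f hf : S' ⟶ S)
      (homMk i hi : A ⟶ S))
    (h₂ : IsPullback (homMk j' hj' : B' ⟶ S') (homMk β hβ : B' ⟶ B) (homMk f hf : S' ⟶ S)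
      (homMk j hj : B ⟶ S)) : IsPointwiseCoproduct i' j' := by
  obtain ⟨e₁, lift₁, mono₁⟩ := isPullback_iff.1 h₁
  obtain ⟨e₂, lift₂, mono₂⟩ := isPullback_iff.1 h₂
  have f₁ : ∀ ⦃T : C⦄ (u : T ⟶ A'.X), S.Eqv ((u ≫ i') ≫ f) ((u ≫ α) ≫ i) := fun T u => by
    simpa using e₁.precomp u
  have f₂ : ∀ ⦃T : C⦄ (u : T ⟶ B'.X), S.Eqv ((u ≫ j') ≫ f) ((u ≫ β) ≫ j) := fun T u => by
    simpa using e₂.precomp u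
  refine ⟨fun T u v huv => mono₁ _ _ huv (h.mono_left ?_),
    fun T u v huv => mono₂ _ _ huv (h.mono_right ?_),
    fun T u v huv => h.disjoint (u := u ≫ α) (v := v ≫ β) ?_, fun T x => ?_⟩
  · exact (f₁ u).symm.trans ((hf _ _ huv).trans (f₁ v))
  · exact (f₂ u).symm.trans ((hf _ _ huv).trans (f₂ v))
  · exact (f₁ u).symm.trans ((hf _ _ huv).trans (f₂ v))
  · obtain ⟨D, E, k, l, a, b, hkl, hk, hl⟩ := h.cover (x ≫ f)
    obtain ⟨a', ha', -⟩ := lift₁ (k ≫ x) a (by simpa using hk)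
    obtain ⟨b', hb', -⟩ := lift₂ (l ≫ x) b (by simpa using hl)
    exact ⟨D, E, k, l, a', b', hkl, ha'.symm, hb'.symm⟩

theorem extensive (hC : IsHomotopyExtensive C) : FinitaryExtensive (Hex C) := by
  have : HasInitial (Hex C) := by
    obtain ⟨Z, hZ⟩ := hC.exists_initial
    have ex : ∀ A : Hex C, Nonempty (y Z ⟶ A) := fun A => ⟨pt (hZ A.X).choose⟩
    have uniq : ∀ {A : Hex C} (φ ψ : y Z ⟶ A), φ = ψ := fun φ ψ => by
      obtain ⟨u, rfl⟩ := exists_pt φ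
      obtain ⟨v, rfl⟩ := exists_pt ψ
      exact pt_eq_iff.2 (hZ.homotopic u v).eqv
    exact (IsInitial.ofUniqueHom (fun A => (ex A).some) (fun _ _ => uniq _ _)).hasInitial
  have : HasBinaryCoproducts (Hex C) := by
    have (A B : Hex C) : HasColimit (pair A B) := by
      obtain ⟨S, i, j, hi, hj, h⟩ := exists_isPointwiseCoproduct hC A B
      obtain ⟨hc⟩ := h.nonempty_isColimit hC (hi := hi) (hj := hj)
      exact ⟨_, hc⟩
    exact hasBinaryCoproducts_of_hasColimit_pair _
  have : HasFiniteCoproducts (Hex C) := hasFiniteCoproducts_of_has_binary_and_initial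
  refine ⟨fun {A B} c hc => ?_⟩
  rw [BinaryCofan.isVanKampen_iff]
  intro A' B' c' α β f hα hβ
  obtain ⟨i, hi, hci⟩ := exists_homMk c.inl
  obtain ⟨j, hj, hcj⟩ := exists_homMk c.inr
  obtain ⟨i', hi', hci'⟩ := exists_homMk c'.inl
  obtain ⟨j', hj', hcj'⟩ := exists_homMk c'.inr
  obtain ⟨α, hα', rfl⟩ := exists_homMk α
  obtain ⟨β, hβ', rfl⟩ := exists_homMk β
  obtain ⟨f, hf, rfl⟩ := exists_homMk f
  have h := (nonempty_isColimit_iff hC hci hcj).1 ⟨hc⟩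
  rw [nonempty_isColimit_iff hC hci' hcj']
  rw [hci, hci'] at hα
  rw [hcj, hcj'] at hβ
  replace hα := homMk_comp_eq_comp_iff.1 hα
  replace hβ := homMk_comp_eq_comp_iff.1 hβ
  rw [hci, hci', hcj, hcj']
  exact ⟨fun h' => ⟨isPullback_of_isPointwiseCoproduct h h' hα hβ,
      isPullback_of_isPointwiseCoproduct h.symm h'.symm hβ hα⟩,
    fun h' => isPointwiseCoproduct_of_isPullback h h'.1 h'.2⟩

end Hex

end PathCat

theorem mainTheorem4 {C : Type u} [Category.{v} C] [CategoryWithFibrations C]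
    [CategoryWithWeakEquivalences C] [PathCat.PathCategory C]
    (hC : PathCat.IsHomotopyExtensive C) :
    PathCat.IsPretopos (PathCat.Hex C) :=
  ⟨PathCat.Hex.regular, fun _ _ _ _ h => PathCat.Hex.effective _ _ h, PathCat.Hex.extensive hC⟩
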